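/- For $n\ge 1$, the (unbiased) clique game $\mathrm{Clique}(n)$ is played on the complete graph $K_n$, all of whose edges are uncoloured at the start. Alice (the first player) and Bob (the second player) alternately colour one uncoloured edge each, Alice colouring it red and Bob colouring it blue, with Alice moving first, until all edges are coloured. Let $A$ and $B$ be the spanning subgraphs of $K_n$ formed by the red and by the blue edges at the end. The score is $\omega(A)-\omega(B)$, where $\omega$ is the clique number; Alice plays to maximise it and Bob plays to minimise it. Alice wins $\mathrm{Clique}(n)$ if she can force a positive score; otherwise Bob wins, that is, he can force a score of at most $0$ (so ties count for Bob). (i) For every $n\ge 8$, if Alice wins $\mathrm{Clique}(n)$, then Bob wins $\mathrm{Clique}(n+3)$. (ii) Bob wins $\mathrm{Clique}(n)$ for every $n$ with $3\le n\le 8$. -/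

import Mathlib

namespace CliqueGame

/-- The score `ω(A) - ω(B)` of a finished game: the order of the largest clique all of whose edges
lie in `A` (red, Alice) minus the order of the largest clique all of whose edges lie in `B`
(blue, Bob). -/
noncomputable def finalScore {V : Type*} (A B : Finset (Sym2 V)) : ℤ :=
  ((SimpleGraph.fromEdgeSet (A : Set (Sym2 V))).cliqueNum : ℤ) -
    ((SimpleGraph.fromEdgeSet (B : Set (Sym2 V))).cliqueNum : ℤ)

/-- The score under optimal play from the position in which `U` is the set of uncoloured edges,
`A` the set of red edges, `B` the set of blue edges, and Alice is to move iff `aliceToMove`.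
The player to move colours one edge of `U` and the turn passes to the other player.
Alice maximises the final score, Bob minimises it. -/
noncomputable def positionScore {V : Type*} [DecidableEq V]
    (aliceToMove : Bool) (U A B : Finset (Sym2 V)) : ℤ :=
  if h : U.Nonempty then
    if aliceToMove then
      U.attach.sup' (Finset.attach_nonempty_iff.mpr h)
        (fun e => positionScore false (U.erase e.1) (insert e.1 A) B)
    else
      U.attach.inf' (Finset.attach_nonempty_iff.mpr h)
        (fun e => positionScore true (U.erase e.1) A (insert e.1 B))
  else finalScore A B
termination_by U.card
decreasing_by
  all_goals exact Finset.card_erase_lt_of_mem e.2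

/-- The score of the unbiased clique game on the graph `G`: no edge is coloured at the start and
Alice makes the first move. -/
noncomputable def score {V : Type*} [DecidableEq V] (G : SimpleGraph V) [Fintype G.edgeSet] : ℤ :=
  positionScore true G.edgeFinset ∅ ∅

/-- The first player wins the clique game on `K_n`: she can force a red clique that is larger than
every blue clique. -/
def FirstPlayerWins (n : ℕ) : Prop :=
  0 < score (⊤ : SimpleGraph (Fin n))

/-- The second player wins the clique game on `K_n`: he can force a final position in which no red
clique is larger than the largest blue clique (so ties count for him). -/
def SecondPlayerWins (n : ℕ) : Prop :=
  score (⊤ : SimpleGraph (Fin n)) ≤ 0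

end CliqueGame

/-! Large boards. On `n + 3` vertices with `9 ≤ n`, Bob spends his first three moves on blue edges
`ab`, `rp`, `rq` with `a`, `b` outside `S = {r, p, q}`, chosen so that all three red edges meet `S`
and at most two vertices outside `S` are joined in red to `p` or `q`. Off `S` there is a fresh board
on `n` vertices where he has made the opening move `ab` and Alice is to move, so there he follows
Alice's winning strategy. On the edges meeting `S` he pairs `xp` with `xq`. The two strategies run
side by side (`Forces.prod`).

At the end let `m` be the size of the largest blue clique off `S`; every red clique off `S` has
fewer than `m` vertices. A red clique with at most one vertex of `S` has at most `m` vertices. Since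
`rp` and `rq` are blue, any other red clique contains `p` and `q` but not `r`, and the pairing
leaves at most two further vertices, so it has at most four. Finally `4 ≤ m` because `R(3, 4) ≤ 9`:
with a red triangle, winning needs a blue 4-clique; without one, Ramsey supplies it
(`cliqueLE_of_bigCliqueLT`).

Small boards. By symmetry one opening move suffices. For `n = 3, 4` the Erdős–Selfridge criterion
lets Bob hit every triangle. For `n = 5, 6, 7` a verified game search shows that he hits every 4-set
and builds a triangle. For `n = 8` the search only hits the 4-sets; the triangle then follows by
counting blue edges. In particular the implication for large boards is vacuous at `n = 8`. -/

namespace CliqueGame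

/-! ### Positional games: monotonicity, sums of boards, pairing, renaming. -/

section Forces

variable {E : Type*} [DecidableEq E]

/-- In a game where two players alternately claim elements of the finite set `U`, with `M` and `T`
the sets already claimed by the player under consideration and by the opponent, this player can
force that the final sets satisfy `Q`. The player is to move iff `t` is `true`. -/
inductive Forces (Q : Finset E → Finset E → Prop) :
    Bool → Finset E → Finset E → Finset E → Prop
  | finish {t : Bool} {U M T : Finset E} : U = ∅ → Q M T → Forces Q t U M T
  | move {U M T : Finset E} (e : E) : e ∈ U →
      Forces Q false (U.erase e) (insert e M) T → Forces Q true U M T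
  | reply {U M T : Finset E} : U.Nonempty →
      (∀ e ∈ U, Forces Q true (U.erase e) M (insert e T)) → Forces Q false U M T

variable {Q Q' : Finset E → Finset E → Prop} {t : Bool} {U M T : Finset E}

theorem Forces.of_empty (h : Forces Q t ∅ M T) : Q M T := by
  generalize hU : (∅ : Finset E) = U at h
  cases h with
  | finish _ h => exact h
  | move e he _ => simp [← hU] at he
  | reply hn _ => simp [← hU] at hn

theorem Forces.reply_mem (h : Forces Q false U M T) {e : E} (he : e ∈ U) :
    Forces Q true (U.erase e) M (insert e T) := by
  cases h with
  | finish hU _ => simp [hU] at he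
  | reply _ h => exact h e he

theorem Forces.exists_move (h : Forces Q true U M T) (hU : U.Nonempty) :
    ∃ e ∈ U, Forces Q false (U.erase e) (insert e M) T := by
  cases h with
  | finish h _ => simp [h] at hU
  | move e he h => exact ⟨e, he, h⟩

theorem forces_false_of (h0 : U = ∅ → Q M T)
    (h : ∀ e ∈ U, Forces Q true (U.erase e) M (insert e T)) : Forces Q false U M T := by
  rcases U.eq_empty_or_nonempty with hU | hU
  · exact .finish hU (h0 hU)
  · exact .reply hU h

theorem Forces.mono (h : Forces Q t U M T) (hQ : ∀ M T, Q M T → Q' M T) : Forces Q' t U M T := by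
  induction h with
  | finish hU h => exact .finish hU (hQ _ _ h)
  | move e he _ ih => exact .move e he ih
  | reply hU _ ih => exact .reply hU ih

/-- What holds of every final position can be added to the goal. -/
theorem Forces.with_final (h : Forces Q t U M T) :
    Forces (fun M' T' => Q M' T' ∧ M ⊆ M' ∧ T' ⊆ T ∪ U ∧ M' ∪ T' = M ∪ T ∪ U ∧
      2 * T'.card ≤ 2 * T.card + U.card + 1) t U M T := by
  -- The bounds `M₀`, `X`, `Y`, `c` stay fixed while the position changes along the induction. The
  -- budget `c` has a surplus of one only when the opponent is to move, who then takes the larger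
  -- half.
  suffices H : ∀ c : ℕ, ∀ M₀ X Y : Finset E, M₀ ⊆ M → T ∪ U ⊆ X → M ∪ T ∪ U = Y →
      2 * T.card + U.card + (if t then 0 else 1) ≤ c →
      Forces (fun M' T' => Q M' T' ∧ M₀ ⊆ M' ∧ T' ⊆ X ∧ M' ∪ T' = Y ∧ 2 * T'.card ≤ c) t U M T from
    (H (2 * T.card + U.card + 1) M (T ∪ U) _ subset_rfl subset_rfl rfl
      (by split_ifs <;> omega))
  induction h with
  | @finish t U M T hU h =>
    intro c M₀ X Y h1 h2 h3 h4
    subst hU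
    simp only [Finset.union_empty] at h2 h3
    exact .finish rfl ⟨h, h1, h2, h3, by omega⟩
  | @move U M T e he _ ih =>
    intro c M₀ X Y h1 h2 h3 h4
    refine .move e he (ih c M₀ X Y (h1.trans (Finset.subset_insert _ _)) ?_ ?_ ?_)
    · exact (Finset.union_subset_union_right (Finset.erase_subset _ _)).trans h2
    · rw [← h3]
      ext x
      by_cases hx : x = e <;> simp [hx, he]
    · have := Finset.card_erase_add_one he
      simp only [if_true, Bool.false_eq_true, if_false] at h4 ⊢
      omega
  | @reply U M T hU _ ih =>
    intro c M₀ X Y h1 h2 h3 h4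
    refine .reply hU fun e he => ih e he c M₀ X Y h1 ?_ ?_ ?_
    · refine fun x hx => h2 ?_
      simp only [Finset.mem_union, Finset.mem_insert, Finset.mem_erase] at hx ⊢
      rcases hx with (rfl | hx) | hx
      · exact .inr he
      · exact .inl hx
      · exact .inr hx.2
    · rw [← h3]
      ext x
      by_cases hx : x = e <;> simp [hx, he]
    · have := Finset.card_erase_add_one he
      have := Finset.card_insert_le e T
      simp only [if_true, Bool.false_eq_true, if_false] at h4 ⊢
      omega

theorem Forces.with_disjoint (h : Forces Q t U M T) (hMT : Disjoint M T) (hUM : Disjoint U M)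
    (hUT : Disjoint U T) : Forces (fun M' T' => Q M' T' ∧ Disjoint M' T') t U M T := by
  induction h with
  | finish hU h => exact .finish hU ⟨h, hMT⟩
  | move e he _ ih =>
    refine .move e he (ih ?_ ?_ ?_)
    · exact Finset.disjoint_insert_left.2 ⟨Finset.disjoint_left.1 hUT he, hMT⟩
    · exact Finset.disjoint_insert_right.2
        ⟨Finset.notMem_erase _ _, hUM.mono_left (Finset.erase_subset _ _)⟩
    · exact hUT.mono_left (Finset.erase_subset _ _)
  | reply hU _ ih =>
    refine .reply hU fun e he => ih e he ?_ ?_ ?_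
    · exact Finset.disjoint_insert_right.2 ⟨Finset.disjoint_left.1 hUM he, hMT⟩
    · exact hUM.mono_left (Finset.erase_subset _ _)
    · exact Finset.disjoint_insert_right.2
        ⟨Finset.notMem_erase _ _, hUT.mono_left (Finset.erase_subset _ _)⟩

/-- The goal can only get easier when the player owns more and the opponent owns less. -/
def Monotone₂ (Q : Finset E → Finset E → Prop) : Prop :=
  ∀ ⦃M M' T T' : Finset E⦄, M ⊆ M' → T' ⊆ T → Q M T → Q M' T'

/-- An extra move does no harm, nor does having the move. -/
theorem Forces.extra_move (hQ : Monotone₂ Q) (n : ℕ) :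
    ∀ {U M T : Finset E}, U.card = n → Forces Q false U M T →
      (∀ e ∈ U, Forces Q false (U.erase e) (insert e M) T) ∧ Forces Q true U M T := by
  induction n using Nat.strong_induction_on with
  | _ n ih =>
  intro U M T hn h
  have key : ∀ e ∈ U, Forces Q false (U.erase e) (insert e M) T := by
    intro e he
    refine forces_false_of (fun hU => ?_) fun g hg => ?_
    · have h1 := h.reply_mem he
      rw [hU] at h1
      exact hQ (Finset.subset_insert _ _) (Finset.subset_insert _ _) h1.of_empty
    · have hgU := Finset.mem_of_mem_erase hg
      have hge := Finset.ne_of_mem_erase hg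
      have hc := Finset.card_erase_add_one hgU
      have heg : e ∈ U.erase g := Finset.mem_erase.2 ⟨hge.symm, he⟩
      obtain ⟨f, hf, h2⟩ := (h.reply_mem hgU).exists_move ⟨e, heg⟩
      have hc2 := Finset.card_erase_add_one hf
      rw [Finset.erase_right_comm]
      -- If the strategy asks for the element taken in advance, the surplus becomes having the move;
      -- otherwise `f` is played and `e` remains the surplus.
      by_cases hfe : f = e
      · subst hfe
        exact (ih _ (by omega) rfl h2).2
      · have h3 := (ih _ (by omega) rfl h2).1 e (Finset.mem_erase.2 ⟨Ne.symm hfe, heg⟩)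
        refine .move f (Finset.mem_erase.2 ⟨hfe, hf⟩) ?_
        rwa [Finset.erase_right_comm, Finset.insert_comm]
  refine ⟨key, ?_⟩
  rcases U.eq_empty_or_nonempty with rfl | ⟨e, he⟩
  · exact .finish rfl h.of_empty
  · exact .move e he (key e he)

/-- Two games on disjoint boards played at the same time. -/
theorem Forces.prod {Q₁ Q₂ : Finset E → Finset E → Prop} (h₁ : Monotone₂ Q₁)
    (h₂ : Monotone₂ Q₂) (n : ℕ) :
    ∀ {U₁ M₁ T₁ U₂ M₂ T₂ : Finset E}, (U₁ ∪ U₂).card = n → Disjoint U₁ U₂ →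
      Forces Q₁ false U₁ M₁ T₁ → Forces Q₂ false U₂ M₂ T₂ →
      Forces (fun M T => ∃ M₁ T₁ M₂ T₂, Q₁ M₁ T₁ ∧ Q₂ M₂ T₂ ∧ M = M₁ ∪ M₂ ∧ T = T₁ ∪ T₂)
        false (U₁ ∪ U₂) (M₁ ∪ M₂) (T₁ ∪ T₂) := by
  induction n using Nat.strong_induction_on generalizing Q₁ Q₂ with
  | _ n ih =>
  intro U₁ M₁ T₁ U₂ M₂ T₂ hn hd f₁ f₂
  refine forces_false_of (fun hU => ?_) ?_
  · obtain ⟨rfl, rfl⟩ := Finset.union_eq_empty.1 hU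
    exact ⟨_, _, _, _, f₁.of_empty, f₂.of_empty, rfl, rfl⟩
  suffices H : ∀ (Q₁ Q₂ : Finset E → Finset E → Prop) (h₁ : Monotone₂ Q₁) (h₂ : Monotone₂ Q₂)
      {U₁ M₁ T₁ U₂ M₂ T₂ : Finset E}, (U₁ ∪ U₂).card = n → Disjoint U₁ U₂ →
      Forces Q₁ false U₁ M₁ T₁ → Forces Q₂ false U₂ M₂ T₂ → ∀ e ∈ U₁,
      Forces (fun M T => ∃ M₁ T₁ M₂ T₂, Q₁ M₁ T₁ ∧ Q₂ M₂ T₂ ∧ M = M₁ ∪ M₂ ∧ T = T₁ ∪ T₂)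
        true ((U₁ ∪ U₂).erase e) (M₁ ∪ M₂) (insert e (T₁ ∪ T₂)) by
    intro e he
    rcases Finset.mem_union.1 he with he | he
    · exact H Q₁ Q₂ h₁ h₂ hn hd f₁ f₂ e he
    · have := H Q₂ Q₁ h₂ h₁ (by rwa [Finset.union_comm]) hd.symm f₂ f₁ e he
      rw [Finset.union_comm U₁, Finset.union_comm M₁, Finset.union_comm T₁]
      refine this.mono ?_
      rintro M T ⟨A, B, C, D, h, h', rfl, rfl⟩
      exact ⟨C, D, A, B, h', h, Finset.union_comm _ _, Finset.union_comm _ _⟩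
  clear! U₁ U₂ M₁ M₂ T₁ T₂ Q₁ Q₂
  intro Q₁ Q₂ h₁ h₂ U₁ M₁ T₁ U₂ M₂ T₂ hn hd f₁ f₂ e he
  have he2 : e ∉ U₂ := Finset.disjoint_left.1 hd he
  have hE : (U₁ ∪ U₂).erase e = U₁.erase e ∪ U₂ := by
    rw [Finset.erase_union_distrib, Finset.erase_eq_of_notMem he2]
  have hc := Finset.card_erase_add_one (Finset.mem_union_left U₂ he)
  have hd' : Disjoint (U₁.erase e) U₂ := hd.mono_left (Finset.erase_subset _ _)
  rw [← Finset.insert_union, hE]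
  rw [hE] at hc
  -- Replies stay on the opponent's board. If it is used up, an arbitrary move is made on the other
  -- one, harmless by `Forces.extra_move`.
  rcases (U₁.erase e).eq_empty_or_nonempty with h0 | hne
  · have g₁ : Forces Q₁ false (U₁.erase e) M₁ (insert e T₁) :=
      .finish h0 ((h0 ▸ f₁.reply_mem he).of_empty)
    rcases U₂.eq_empty_or_nonempty with rfl | ⟨g, hg⟩
    · refine .finish (by simp [h0]) ⟨_, _, _, _, (h0 ▸ g₁).of_empty, f₂.of_empty, rfl, rfl⟩
    · refine .move g (Finset.mem_union_right _ hg) ?_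
      have g₂ := (Forces.extra_move h₂ _ rfl f₂).1 g hg
      have hg1 : g ∉ U₁.erase e := Finset.disjoint_right.1 hd' hg
      have hE2 : (U₁.erase e ∪ U₂).erase g = U₁.erase e ∪ U₂.erase g := by
        rw [Finset.erase_union_distrib, Finset.erase_eq_of_notMem hg1]
      have hc' := Finset.card_erase_add_one (Finset.mem_union_right (U₁.erase e) hg)
      rw [hE2] at hc' ⊢
      rw [← Finset.union_insert]
      exact ih _ (by omega) h₁ h₂ rfl (hd'.mono_right (Finset.erase_subset _ _)) g₁ g₂
  · obtain ⟨g, hg, g₁⟩ := (f₁.reply_mem he).exists_move hne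
    refine .move g (Finset.mem_union_left _ hg) ?_
    have hg2 : g ∉ U₂ := Finset.disjoint_left.1 hd' hg
    have hE2 : (U₁.erase e ∪ U₂).erase g = (U₁.erase e).erase g ∪ U₂ := by
      rw [Finset.erase_union_distrib, Finset.erase_eq_of_notMem hg2]
    have hc' := Finset.card_erase_add_one (Finset.mem_union_left U₂ hg)
    rw [hE2] at hc' ⊢
    rw [← Finset.insert_union]
    exact ih _ (by omega) h₁ h₂ rfl (hd'.mono_left (Finset.erase_subset _ _)) g₁ f₂

/-- The pairing strategy: answering in the same pair, the player keeps the opponent from owning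
both elements of a pair `{e, σ e}` with `e ∈ P`. -/
theorem forces_pairing (σ : E → E) (hσ : ∀ e, σ (σ e) = e) (P : Finset E)
    (hP : ∀ e ∈ P, σ e ≠ e ∧ σ e ∈ P) (n : ℕ) :
    ∀ {U M T : Finset E}, U.card = n → (∀ e ∈ P, e ∈ T → σ e ∉ T ∧ σ e ∉ U) →
      Forces (fun _ T' => ∀ e ∈ P, e ∈ T' → σ e ∉ T') false U M T := by
  induction n using Nat.strong_induction_on with
  | _ n ih =>
  intro U M T hn hT
  refine forces_false_of (fun _ e he h => (hT e he h).1) fun e he => ?_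
  have hc := Finset.card_erase_add_one he
  have hne : ∀ x ∈ P, x ∈ T → σ x ≠ e := fun x hx hxT h => (hT x hx hxT).2 (h ▸ he)
  -- The invariant says that the partner of an opponent's element is neither free nor the
  -- opponent's. Any answer `f` after which `σ e` is not free restores it, so `f` is arbitrary when
  -- `σ e` was already taken.
  have main : ∀ f ∈ U.erase e, (e ∈ P → σ e ∈ (U.erase e).erase f → False) →
      Forces (fun _ T' => ∀ e ∈ P, e ∈ T' → σ e ∉ T') true (U.erase e) M (insert e T) := by
    intro f hf hef
    have hc' := Finset.card_erase_add_one hf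
    refine .move f hf (ih _ (by omega) rfl fun x hx hxT => ?_)
    rw [Finset.mem_insert] at hxT
    by_cases hxe : x = e
    · subst hxe
      refine ⟨fun h => ?_, hef hx⟩
      rcases Finset.mem_insert.1 h with h | h
      · exact (hP x hx).1 h
      · exact hne _ (hP x hx).2 h (hσ x)
    · have hxT := hxT.resolve_left hxe
      refine ⟨fun h => ?_, fun h => ?_⟩
      · rcases Finset.mem_insert.1 h with h | h
        · exact hne x hx hxT h
        · exact (hT x hx hxT).1 h
      · exact (hT x hx hxT).2 (Finset.mem_of_mem_erase (Finset.mem_of_mem_erase h))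
  by_cases h : e ∈ P ∧ σ e ∈ U.erase e
  · exact main (σ e) h.2 fun _ h => by simp at h
  · rcases (U.erase e).eq_empty_or_nonempty with h0 | ⟨f, hf⟩
    · refine .finish h0 fun x hx hxT hxT' => ?_
      rw [Finset.mem_insert] at hxT hxT'
      rcases hxT with rfl | hxT
      · rcases hxT' with h | h
        · exact (hP x hx).1 h
        · exact hne _ (hP x hx).2 h (hσ x)
      · rcases hxT' with h | h
        · exact hne x hx hxT h
        · exact (hT x hx hxT).1 h
    · exact main f hf fun h1 h2 => h ⟨h1, Finset.mem_of_mem_erase h2⟩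

/-- Renaming the elements of the board. -/
theorem Forces.map {E' : Type*} [DecidableEq E'] (φ : E → E') {R : Finset E' → Finset E' → Prop}
    (h : Forces Q t U M T) (hφ : Set.InjOn φ U)
    (hR : ∀ M T, Q M T → R (M.image φ) (T.image φ)) :
    Forces R t (U.image φ) (M.image φ) (T.image φ) := by
  have herase : ∀ {U : Finset E} {e : E}, Set.InjOn φ U → e ∈ U →
      (U.image φ).erase (φ e) = (U.erase e).image φ := by
    intro U e hU he
    ext y
    simp only [Finset.mem_erase, Finset.mem_image]
    constructor
    · rintro ⟨hy, x, hx, rfl⟩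
      exact ⟨x, ⟨fun h => hy (h ▸ rfl), hx⟩, rfl⟩
    · rintro ⟨x, ⟨hx, hxU⟩, rfl⟩
      exact ⟨fun h => hx (hU hxU he h), x, hxU, rfl⟩
  have hsub : ∀ {U : Finset E} {e : E}, Set.InjOn φ U → Set.InjOn φ (U.erase e) :=
    fun hU => hU.mono (by exact_mod_cast Finset.erase_subset _ _)
  induction h with
  | finish hU h => exact .finish (by simp [hU]) (hR _ _ h)
  | move e he _ ih =>
    refine .move (φ e) (Finset.mem_image_of_mem _ he) ?_
    rw [herase hφ he, ← Finset.image_insert]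
    exact ih (hsub hφ)
  | reply hU _ ih =>
    refine .reply (hU.image _) fun y hy => ?_
    obtain ⟨e, he, rfl⟩ := Finset.mem_image.1 hy
    rw [herase hφ he, ← Finset.image_insert]
    exact ih e he (hsub hφ)

end Forces

/-! ### Translation between scores and forced outcomes. -/

section Score

variable {V : Type*}

/-- All pairs of distinct elements of `s` are edges in `A`. -/
def IsClq (A : Finset (Sym2 V)) (s : Finset V) : Prop :=
  ∀ x ∈ s, ∀ y ∈ s, x ≠ y → s(x, y) ∈ A

theorem IsClq.mono {A B : Finset (Sym2 V)} {s t : Finset V} (h : IsClq A s) (hAB : A ⊆ B)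
    (hts : t ⊆ s) : IsClq B t :=
  fun x hx y hy hxy => hAB (h x (hts hx) y (hts hy) hxy)

theorem isClq_iff (A : Finset (Sym2 V)) (s : Finset V) :
    (SimpleGraph.fromEdgeSet (A : Set (Sym2 V))).IsClique s ↔ IsClq A s := by
  simp only [SimpleGraph.isClique_iff, Set.Pairwise, SimpleGraph.fromEdgeSet_adj, IsClq,
    Finset.mem_coe]
  exact ⟨fun h x hx y hy hxy => (h hx hy hxy).1, fun h x hx y hy hxy => ⟨h x hx y hy hxy, hxy⟩⟩

/-- The largest clique of `T` is at most as large as that of `M`. -/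
def CliqueLE (M T : Finset (Sym2 V)) : Prop :=
  ∀ s, IsClq T s → ∃ s', IsClq M s' ∧ s.card ≤ s'.card

/-- The largest clique of `T` is smaller than that of `M`. -/
def CliqueLT (M T : Finset (Sym2 V)) : Prop :=
  ∃ s', IsClq M s' ∧ ∀ s, IsClq T s → s.card < s'.card

theorem IsClq.card_le_cliqueNum [Finite V] {A : Finset (Sym2 V)} {s : Finset V} (h : IsClq A s) :
    s.card ≤ (SimpleGraph.fromEdgeSet (A : Set (Sym2 V))).cliqueNum :=
  ((isClq_iff A s).2 h).card_le_cliqueNum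

theorem exists_isClq_card_eq_cliqueNum (A : Finset (Sym2 V)) :
    ∃ s, IsClq A s ∧ s.card = (SimpleGraph.fromEdgeSet (A : Set (Sym2 V))).cliqueNum := by
  obtain ⟨s, hs⟩ := (SimpleGraph.fromEdgeSet (A : Set (Sym2 V))).exists_isNClique_cliqueNum
  exact ⟨s, (isClq_iff A s).1 hs.isClique, hs.card_eq⟩

theorem CliqueLE.finalScore_le [Finite V] {A B : Finset (Sym2 V)} (h : CliqueLE B A) :
    finalScore A B ≤ 0 := by
  obtain ⟨s, hs, hc⟩ := exists_isClq_card_eq_cliqueNum A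
  obtain ⟨s', hs', hc'⟩ := h s hs
  have := hs'.card_le_cliqueNum
  simp only [finalScore]
  omega

theorem cliqueLT_of_finalScore_pos [Finite V] {A B : Finset (Sym2 V)} (h : 0 < finalScore A B) :
    CliqueLT A B := by
  obtain ⟨s, hs, hc⟩ := exists_isClq_card_eq_cliqueNum A
  refine ⟨s, hs, fun s' hs' => ?_⟩
  have := hs'.card_le_cliqueNum
  simp only [finalScore] at h
  omega

theorem positionScore_le_of_forces [Finite V] [DecidableEq V] (n : ℕ) : ∀ (t : Bool) (U A B : Finset (Sym2 V)),
    U.card = n → Forces CliqueLE t U B A → positionScore (!t) U A B ≤ 0 := by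
  induction n using Nat.strong_induction_on with
  | _ n ih =>
  intro t U A B hn h
  rw [positionScore]
  split_ifs with hU ht
  · obtain rfl : t = false := by simpa using ht
    rw [Finset.sup'_le_iff]
    intro e _
    exact ih _ (by have := Finset.card_erase_add_one e.2; omega) true _ _ _ rfl (h.reply_mem e.2)
  · obtain rfl : t = true := by simpa using ht
    rw [Finset.inf'_le_iff]
    obtain ⟨e, he, h'⟩ := h.exists_move hU
    have := Finset.card_erase_add_one he
    exact ⟨⟨e, he⟩, Finset.mem_attach _ _, ih (U.erase e).card (by omega) false _ _ _ rfl h'⟩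
  · obtain rfl := Finset.not_nonempty_iff_eq_empty.1 hU
    exact h.of_empty.finalScore_le

theorem forces_of_positionScore_pos [Finite V] [DecidableEq V] (n : ℕ) : ∀ (t : Bool) (U A B : Finset (Sym2 V)),
    U.card = n → 0 < positionScore t U A B → Forces CliqueLT t U A B := by
  induction n using Nat.strong_induction_on with
  | _ n ih =>
  intro t U A B hn h
  rw [positionScore] at h
  split_ifs at h with hU ht
  · subst ht
    rw [Finset.lt_sup'_iff] at h
    obtain ⟨e, _, h⟩ := h
    exact .move e.1 e.2
      (ih _ (by have := Finset.card_erase_add_one e.2; omega) false _ _ _ rfl h)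
  · obtain rfl : t = false := by simpa using ht
    rw [Finset.lt_inf'_iff] at h
    refine .reply hU fun e he => ?_
    have := Finset.card_erase_add_one he
    exact ih _ (by omega) true _ _ _ rfl (h ⟨e, he⟩ (Finset.mem_attach _ _))
  · obtain rfl := Finset.not_nonempty_iff_eq_empty.1 hU
    exact .finish rfl (cliqueLT_of_finalScore_pos h)

/-- All edges of the complete graph. -/
def allEdges (V : Type*) [DecidableEq V] [Fintype V] : Finset (Sym2 V) :=
  Finset.univ.filter fun e => ¬ e.IsDiag

theorem mem_allEdges [DecidableEq V] [Fintype V] {x y : V} : s(x, y) ∈ allEdges V ↔ x ≠ y := by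
  simp [allEdges]

theorem score_top_eq (n : ℕ) :
    score (⊤ : SimpleGraph (Fin n)) = positionScore true (allEdges (Fin n)) ∅ ∅ := by
  rw [score]
  congr 1
  ext e
  induction e with
  | _ x y => rw [mem_allEdges]; simp

theorem secondPlayerWins_of_forces {n : ℕ}
    (h : Forces CliqueLE false (allEdges (Fin n)) ∅ ∅) : SecondPlayerWins n := by
  rw [SecondPlayerWins, score_top_eq]
  exact positionScore_le_of_forces _ false _ _ _ rfl h

theorem FirstPlayerWins.forces {n : ℕ} (h : FirstPlayerWins n) :
    Forces CliqueLT true (allEdges (Fin n)) ∅ ∅ := by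
  rw [FirstPlayerWins, score_top_eq] at h
  exact forces_of_positionScore_pos _ true _ _ _ rfl h

end Score

/-! ### Vectors of weights as digits of a single number. -/

section Packing

variable {K : Type*}

/-- A list of weights packed into one number, in base `2 ^ 16`. -/
def pack (ks : List K) (w : K → ℕ) : ℕ :=
  ks.foldr (fun k r => w k + 2 ^ 16 * r) 0

theorem pack_congr {ks : List K} {w v : K → ℕ} (h : ∀ k ∈ ks, w k = v k) :
    pack ks w = pack ks v := by
  induction ks with
  | nil => rfl
  | cons k ks ih =>
    simp only [pack, List.foldr_cons] at ih ⊢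
    rw [h k (by simp), ih fun k hk => h k (by simp [hk])]

theorem pack_add (ks : List K) (w v : K → ℕ) :
    pack ks (fun k => w k + v k) = pack ks w + pack ks v := by
  induction ks with
  | nil => rfl
  | cons k ks ih =>
    simp only [pack, List.foldr_cons] at ih ⊢
    rw [ih]
    ring

theorem land_add_mul {a b : ℕ} (ha : a < 2 ^ 16) (hb : b < 2 ^ 16) (x y : ℕ) :
    Nat.land (a + 2 ^ 16 * x) (b + 2 ^ 16 * y) = Nat.land a b + 2 ^ 16 * Nat.land x y := by
  change (a + 2 ^ 16 * x) &&& (b + 2 ^ 16 * y) = (a &&& b) + 2 ^ 16 * (x &&& y)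
  refine Nat.eq_of_testBit_eq fun i => ?_
  rw [add_comm, add_comm b, add_comm (a &&& b), Nat.testBit_and,
    Nat.testBit_two_pow_mul_add _ ha, Nat.testBit_two_pow_mul_add _ hb,
    Nat.testBit_two_pow_mul_add _ (Nat.and_lt_two_pow _ hb)]
  split_ifs <;> simp

theorem land_pack {ks : List K} {w v : K → ℕ} (hw : ∀ k ∈ ks, w k < 2 ^ 16)
    (hv : ∀ k ∈ ks, v k < 2 ^ 16) :
    Nat.land (pack ks w) (pack ks v) = pack ks fun k => Nat.land (w k) (v k) := by
  induction ks with
  | nil => exact Nat.zero_and 0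
  | cons k ks ih =>
    have := ih (fun k hk => hw k (by simp [hk])) (fun k hk => hv k (by simp [hk]))
    simp only [pack, List.foldr_cons] at this ⊢
    rw [land_add_mul (hw k (by simp)) (hv k (by simp)), this]

/-- Holds because `2 ^ 16` is congruent to `1` modulo `65535`: one remainder computes a digit sum.
-/
theorem pack_mod (ks : List K) (w : K → ℕ) :
    pack ks w % 65535 = (ks.map w).sum % 65535 := by
  induction ks with
  | nil => rfl
  | cons k ks ih =>
    simp only [pack, List.foldr_cons, List.map_cons, List.sum_cons] at ih ⊢
    omega

theorem exists_of_pack_ne_zero {ks : List K} {w : K → ℕ} (h : pack ks w ≠ 0) :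
    ∃ k ∈ ks, w k ≠ 0 := by
  by_contra! H
  refine h ((pack_congr H).trans ?_)
  clear h H
  induction ks with
  | nil => rfl
  | cons k ks ih =>
    simp only [pack, List.foldr_cons, zero_add] at ih ⊢
    rw [ih, mul_zero]

end Packing

/-! ### The game search, in a form that the kernel evaluates quickly. -/

section Checker

/-- The sum of the digits of the part of `X` selected by the digit mask `e`. -/
def degree (X e : ℕ) : ℕ := Nat.mod (Nat.land X e) 65535

/-- Double the digits selected by `e`. -/
def doubled (X e : ℕ) : ℕ := Nat.add X (Nat.land X e)

/-- Delete the digits selected by `e`. -/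
def deleted (X e : ℕ) : ℕ := Nat.sub X (Nat.land X e)

/-- Application to an evaluated argument: this makes the kernel evaluate `n` once. -/
def forced {α : Type} (n : ℕ) (f : ℕ → α) : α := Nat.rec (f 0) (fun m _ => f (Nat.succ m)) n

/-- The edge that maximises a weighted sum of the degrees. -/
def best (c X Y : ℕ) (U : List (ℕ × ℕ)) : ℕ × ℕ → ℕ → (ℕ × ℕ → Bool) → Bool :=
  List.rec (fun f _ F => F f)
    (fun e _ ih f s F => forced (Nat.add (degree X e.1) (Nat.mul c (degree Y e.2))) fun d =>
      (Nat.ble d s).rec (ih e d F) (ih f s F)) U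

/-- `U` without the edge `e`. -/
def without (e : ℕ × ℕ) (U : List (ℕ × ℕ)) : (List (ℕ × ℕ) → Bool) → Bool :=
  List.rec (fun F => F [])
    (fun x _ ih F => (Nat.beq x.1 e.1).rec (ih fun l => F (x :: l)) (ih F)) U

/-- Whether some digit of `Y` has reached `8`. -/
def isDone (D Y : ℕ) : Bool := !Nat.beq (Nat.land Y D) 0

/-- Search for a proof that the player to move wins. The digits of `X` are the weights of the sets
that the opponent must not complete, those of `Y` the weights of the sets one of which the player
has to complete; each free edge is given by the masks of the sets that contain it. -/
def check (c D : ℕ) : ℕ → List (ℕ × ℕ) → ℕ → ℕ → Bool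
  | 0, _, _, _ => false
  | _ + 1, [], _, _ => false
  | n + 1, x :: U, X, Y =>
    best c X (bif isDone D Y then 0 else Y) (x :: U) x 0 fun f =>
    without f (x :: U) fun U' =>
    forced (bif isDone D (doubled Y f.2) then Nat.mod (deleted X f.1) 65535 else 64) fun s =>
    (!U'.isEmpty || Nat.ble s 63) &&
    U'.all fun e =>
      Nat.ble (Nat.add s (degree (deleted X f.1) e.1)) 63 ||
      without e U' fun U'' =>
        check c D n U'' (doubled (deleted X f.1) e.1) (deleted (doubled Y f.2) e.2)

end Checker

/-! ### Weight invariants and the Erdős–Selfridge criterion. -/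

section Weights

variable {E K : Type}

/-- The digit mask of the sets that contain `e`. -/
def digitMask (has : K → E → Bool) (ks : List K) (e : E) : ℕ :=
  pack ks fun k => bif has k e then 65535 else 0

/-- The digit masks of the sets from two families that contain `e`. -/
def code (has : K → E → Bool) (ks gs : List K) (e : E) : ℕ × ℕ :=
  (digitMask has ks e, digitMask has gs e)

def doubleAt (has : K → E → Bool) (w : K → ℕ) (e : E) (k : K) : ℕ :=
  bif has k e then 2 * w k else w k

def deleteAt (has : K → E → Bool) (w : K → ℕ) (e : E) (k : K) : ℕ :=
  bif has k e then 0 else w k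

/-- The part of `w` on the sets that contain `e`. -/
def partAt (has : K → E → Bool) (w : K → ℕ) (e : E) (k : K) : ℕ :=
  bif has k e then w k else 0

variable {has : K → E → Bool} {ks gs : List K} {w v : K → ℕ} {e f : E} {U₀ U M T : Finset E}

theorem land_digitMask (hw : ∀ k ∈ ks, w k ≤ 64) :
    Nat.land (pack ks w) (digitMask has ks e) = pack ks (partAt has w e) := by
  rw [digitMask, land_pack (fun k hk => (hw k hk).trans_lt (by norm_num))
    (fun k _ => by cases has k e <;> simp)]
  refine pack_congr fun k hk => ?_
  have := hw k hk
  cases h : has k e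
  · simp only [partAt, h, cond_false]
    exact Nat.and_zero _
  · simp only [partAt, h, cond_true]
    exact (Nat.and_two_pow_sub_one_eq_mod (w k) 16).trans (Nat.mod_eq_of_lt (by omega))

theorem doubled_pack (hw : ∀ k ∈ ks, w k ≤ 64) :
    doubled (pack ks w) (digitMask has ks e) = pack ks (doubleAt has w e) := by
  rw [doubled, land_digitMask hw]
  refine (pack_add ks w _).symm.trans (pack_congr fun k _ => ?_)
  cases h : has k e <;> simp [partAt, doubleAt, h, two_mul]

theorem deleted_pack (hw : ∀ k ∈ ks, w k ≤ 64) :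
    deleted (pack ks w) (digitMask has ks e) = pack ks (deleteAt has w e) := by
  rw [deleted, land_digitMask hw]
  refine Nat.sub_eq_of_eq_add ((pack_congr fun k _ => ?_).trans (pack_add ks _ _))
  cases h : has k e <;> simp [partAt, deleteAt, h]

theorem sum_le_of_le (hw : ∀ k ∈ ks, w k ≤ 64) : (ks.map w).sum ≤ ks.length * 64 := by
  have := List.sum_le_card_nsmul (ks.map w) 64 (by simpa using hw)
  simpa using this

/-- A sum of at most 1000 weights up to 64 is at most 64000, below the modulus `65535`, so nothing
is lost in the remainder. -/
theorem total_pack (hk : ks.length ≤ 1000) (hw : ∀ k ∈ ks, w k ≤ 64) :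
    Nat.mod (pack ks w) 65535 = (ks.map w).sum := by
  have := sum_le_of_le hw
  exact (pack_mod ks w).trans (Nat.mod_eq_of_lt (by omega))

theorem partAt_le (k : K) : partAt has w e k ≤ w k := by
  cases h : has k e <;> simp [partAt, h]

theorem degree_pack (hk : ks.length ≤ 1000) (hw : ∀ k ∈ ks, w k ≤ 64) :
    degree (pack ks w) (digitMask has ks e) = (ks.map (partAt has w e)).sum := by
  rw [degree, land_digitMask hw]
  exact total_pack hk fun k hk => (partAt_le k).trans (hw k hk)

theorem sum_doubleAt (ks : List K) :
    (ks.map (doubleAt has w e)).sum = (ks.map w).sum + (ks.map (partAt has w e)).sum := by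
  rw [← List.sum_map_add]
  congr 1
  refine List.map_congr_left fun k _ => ?_
  cases h : has k e <;> simp [partAt, doubleAt, h, two_mul]

theorem sum_deleteAt (ks : List K) :
    (ks.map (deleteAt has w e)).sum + (ks.map (partAt has w e)).sum = (ks.map w).sum := by
  rw [← List.sum_map_add]
  congr 1
  refine List.map_congr_left fun k _ => ?_
  cases h : has k e <;> simp [partAt, deleteAt, h]

theorem card_filter_erase [DecidableEq E] (he : e ∈ U) (k : K) :
    ((U.erase e).filter fun x => has k x).card + (bif has k e then 1 else 0) =
      (U.filter fun x => has k x).card := by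
  rw [Finset.filter_erase]
  cases h : has k e
  · rw [Finset.erase_eq_of_notMem (by simp [h])]
    rfl
  · exact Finset.card_erase_add_one (by simp [h, he])

/-- Each set of `ks` has been hit by `M`, or its weight is `64 / 2 ^ j`, where `j` is the number of
its elements that are still free. -/
def Avoiding (has : K → E → Bool) (ks : List K) (U M : Finset E) (w : K → ℕ) : Prop :=
  ∀ k ∈ ks, (w k = 0 ∧ ∃ e ∈ M, has k e) ∨ w k * 2 ^ (U.filter fun x => has k x).card = 64

/-- Each set of `gs` with a positive weight still can be completed, and its weight is at most
`8 / 2 ^ j`, where `j` is the number of its elements that are still free. -/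
def Building (has : K → E → Bool) (gs : List K) (U₀ U M : Finset E) (v : K → ℕ) : Prop :=
  ∀ k ∈ gs, v k = 0 ∨ v k * 2 ^ (U.filter fun x => has k x).card ≤ 8 ∧
    ∀ e ∈ U₀, has k e → e ∈ M ∨ e ∈ U

theorem Avoiding.le (h : Avoiding has ks U M w) : ∀ k ∈ ks, w k ≤ 64 := by
  intro k hk
  rcases h k hk with ⟨h, _⟩ | h
  · simp [h]
  · exact h ▸ Nat.le_mul_of_pos_right _ (by positivity)

theorem Building.le (h : Building has gs U₀ U M v) : ∀ k ∈ gs, v k ≤ 8 := by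
  intro k hk
  rcases h k hk with h | ⟨h, _⟩
  · simp [h]
  · exact (Nat.le_mul_of_pos_right _ (by positivity)).trans h

variable [DecidableEq E]

theorem Avoiding.claim (h : Avoiding has ks U M w) (hf : f ∈ U) :
    Avoiding has ks (U.erase f) (insert f M) (deleteAt has w f) := by
  intro k hk
  have hc := card_filter_erase (has := has) hf k
  cases hkf : has k f
  · simp only [hkf, cond_false, add_zero] at hc
    simp only [deleteAt, hkf, cond_false, hc]
    refine (h k hk).imp_left ?_
    rintro ⟨h0, e, he, hke⟩
    exact ⟨h0, e, Finset.mem_insert_of_mem he, hke⟩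
  · exact .inl ⟨by simp [deleteAt, hkf], f, Finset.mem_insert_self _ _, hkf⟩

theorem Avoiding.lose (h : Avoiding has ks U M w) (he : e ∈ U) :
    Avoiding has ks (U.erase e) M (doubleAt has w e) := by
  intro k hk
  have hc := card_filter_erase (has := has) he k
  rcases h k hk with ⟨h0, hM⟩ | h
  · exact .inl ⟨by simp [doubleAt, h0], hM⟩
  · refine .inr ?_
    cases hke : has k e
    · simp only [hke, cond_false, add_zero] at hc
      simpa only [doubleAt, hke, cond_false, hc] using h
    · simp only [hke, cond_true] at hc
      rw [← hc, pow_succ] at h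
      simp only [doubleAt, hke, cond_true]
      linarith

theorem Building.claim (h : Building has gs U₀ U M v) (hf : f ∈ U) :
    Building has gs U₀ (U.erase f) (insert f M) (doubleAt has v f) := by
  intro k hk
  have hc := card_filter_erase (has := has) hf k
  rcases h k hk with h0 | ⟨h, hU⟩
  · exact .inl (by simp [doubleAt, h0])
  · refine .inr ⟨?_, fun e he hke => ?_⟩
    · cases hkf : has k f
      · simp only [hkf, cond_false, add_zero] at hc
        simpa only [doubleAt, hkf, cond_false, hc] using h
      · simp only [hkf, cond_true] at hc
        rw [← hc, pow_succ] at h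
        simp only [doubleAt, hkf, cond_true]
        linarith
    · by_cases hef : e = f
      · exact .inl (by simp [hef])
      · exact (hU e he hke).imp (Finset.mem_insert_of_mem) fun h => Finset.mem_erase.2 ⟨hef, h⟩

theorem Building.lose (h : Building has gs U₀ U M v) (he : e ∈ U) :
    Building has gs U₀ (U.erase e) M (deleteAt has v e) := by
  intro k hk
  have hc := card_filter_erase (has := has) he k
  cases hke : has k e
  · simp only [hke, cond_false, add_zero] at hc
    simp only [deleteAt, hke, cond_false, hc]
    refine (h k hk).imp_right ?_
    rintro ⟨h8, hU⟩
    refine ⟨h8, fun x hx hkx => (hU x hx hkx).imp_right fun hxU => Finset.mem_erase.2 ⟨?_, hxU⟩⟩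
    rintro rfl
    simp [hke] at hkx
  · exact .inl (by simp [deleteAt, hke])

/-- The Erdős–Selfridge criterion. -/
theorem forces_hit (n : ℕ) : ∀ {U M T : Finset E} {w : K → ℕ}, U.card = n →
    Avoiding has ks U M w → (ks.map w).sum < 64 →
    Forces (fun M' _ => ∀ k ∈ ks, ∃ e ∈ M', has k e) true U M T := by
  induction n using Nat.strong_induction_on with
  | _ n ih =>
  -- On an exhausted board a set that was never hit has weight 64, more than the whole sum.
  have final : ∀ {M : Finset E} {w : K → ℕ}, Avoiding has ks ∅ M w → (ks.map w).sum < 64 →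
      ∀ k ∈ ks, ∃ e ∈ M, has k e := by
    intro M w h hw k hk
    refine ((h k hk).resolve_right fun h => ?_).2
    have := List.single_le_sum (l := ks.map w) (by simp) (w k) (List.mem_map_of_mem hk)
    simp at h
    omega
  intro U M T w hn h hw
  rcases U.eq_empty_or_nonempty with rfl | hU
  · exact .finish rfl (final h hw)
  obtain ⟨f, hf, hmax⟩ := U.exists_max_image (fun e => (ks.map (partAt has w e)).sum) hU
  have hc := Finset.card_erase_add_one hf
  have h' := h.claim hf
  have hd := sum_deleteAt (has := has) (w := w) (e := f) ks
  refine .move f hf (forces_false_of (fun h0 => final (h0 ▸ h') (by omega)) fun e he => ?_)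
  have hc' := Finset.card_erase_add_one he
  refine ih _ (by omega) rfl (h'.lose he) ?_
  rw [sum_doubleAt]
  -- Claiming `f` subtracts its degree; losing `e` adds at most the earlier degree of `e`, which is
  -- no larger by the choice of `f`. So the total does not grow in a round.
  have h1 : (ks.map (partAt has (deleteAt has w f) e)).sum ≤ (ks.map (partAt has w e)).sum := by
    refine List.sum_le_sum fun k _ => ?_
    cases hke : has k e <;> cases hkf : has k f <;> simp [partAt, deleteAt, hke, hkf]
  have h2 := hmax e (Finset.mem_of_mem_erase he)
  omega

end Weights

/-! ### Soundness of the search. -/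

section Soundness

theorem forced_eq {α : Type} (n : ℕ) (f : ℕ → α) : forced n f = f n := by
  cases n <;> rfl

/-- Soundness needs only that some edge of the list is returned; its maximality is a heuristic. -/
theorem best_mem (c X Y : ℕ) (U : List (ℕ × ℕ)) : ∀ (f : ℕ × ℕ) (s : ℕ),
    ∃ f' ∈ f :: U, ∀ F, best c X Y U f s F = F f' := by
  induction U with
  | nil => exact fun f s => ⟨f, by simp, fun _ => rfl⟩
  | cons e U ih =>
    intro f s
    have h : ∀ F, best c X Y (e :: U) f s F =
        bif Nat.ble (Nat.add (degree X e.1) (Nat.mul c (degree Y e.2))) s then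
          best c X Y U f s F else
          best c X Y U e (Nat.add (degree X e.1) (Nat.mul c (degree Y e.2))) F := by
      intro F
      change forced (Nat.add (degree X e.1) (Nat.mul c (degree Y e.2))) (fun d =>
        @Bool.rec (fun _ => Bool) (best c X Y U e d F) (best c X Y U f s F) (Nat.ble d s)) = _
      rw [forced_eq]
      cases Nat.ble (Nat.add (degree X e.1) (Nat.mul c (degree Y e.2))) s <;> rfl
    cases hb : Nat.ble (Nat.add (degree X e.1) (Nat.mul c (degree Y e.2))) s
    · obtain ⟨f', hf', hF⟩ := ih e (Nat.add (degree X e.1) (Nat.mul c (degree Y e.2)))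
      exact ⟨f', List.mem_cons_of_mem _ hf', fun F => by rw [h, hb, cond_false, hF]⟩
    · obtain ⟨f', hf', hF⟩ := ih f s
      refine ⟨f', ?_, fun F => by rw [h, hb, cond_true, hF]⟩
      rcases List.mem_cons.1 hf' with h | h <;> simp [h]

theorem without_eq (e : ℕ × ℕ) (U : List (ℕ × ℕ)) : ∀ F,
    without e U F = F (U.filter fun x => !Nat.beq x.1 e.1) := by
  induction U with
  | nil => exact fun _ => rfl
  | cons x U ih =>
    intro F
    have h : without e (x :: U) F = bif Nat.beq x.1 e.1 then without e U F else
        without e U fun l => F (x :: l) := by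
      cases hb : Nat.beq x.1 e.1 <;> simp only [without, hb, cond_true, cond_false]
    rw [h, ih, ih]
    cases hb : Nat.beq x.1 e.1 <;> simp [hb]

variable {E K : Type} [DecidableEq E] {has : K → E → Bool} {ks gs : List K}

/-- Edges are compared by their masks, so injectivity of the mask ensures that no other edge is
deleted. -/
theorem without_map {U₀ : Finset E}
    (hinj : Set.InjOn (digitMask has ks) U₀) {U : List E} (hU : ∀ e ∈ U, e ∈ U₀)
    (hn : U.Nodup) {e : E} (he : e ∈ U₀) (F : List (ℕ × ℕ) → Bool) :
    without (code has ks gs e) (U.map (code has ks gs)) F =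
      F ((U.erase e).map (code has ks gs)) := by
  rw [without_eq, hn.erase_eq_filter, List.filter_map]
  congr 2
  refine List.filter_congr fun x hx => ?_
  simp only [Function.comp, code]
  by_cases hxe : x = e
  · subst hxe
    simp
  · have : Nat.beq (digitMask has ks x) (digitMask has ks e) = false :=
      Bool.eq_false_iff.2 fun h => hxe (hinj (hU x hx) he (Nat.eq_of_beq_eq_true h))
    rw [this]
    simp [hxe]

theorem toFinset_erase {U : List E} (hn : U.Nodup) (e : E) :
    (U.erase e).toFinset = U.toFinset.erase e := by
  ext x
  simp [hn.mem_erase_iff]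

theorem Building.of_isDone {U₀ U M : Finset E} {v : K → ℕ} (h : Building has gs U₀ U M v)
    (hd : isDone (pack gs fun _ => 8) (pack gs v) = true) :
    ∃ k ∈ gs, ∀ e ∈ U₀, has k e → e ∈ M := by
  have h0 : Nat.land (pack gs v) (pack gs fun _ => 8) ≠ 0 := by
    intro h0
    rw [isDone, h0] at hd
    exact absurd hd (by decide)
  rw [land_pack (fun k hk => (h.le k hk).trans_lt (by norm_num)) (fun _ _ => by norm_num)] at h0
  obtain ⟨k, hk, hne⟩ := exists_of_pack_ne_zero h0
  have h8 := h.le k hk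
  have hv : v k = 8 := by
    by_contra hv
    refine hne ?_
    generalize v k = a at h8 hv
    interval_cases a <;> first | rfl | exact absurd rfl hv
  refine ⟨k, hk, fun e he hke => ?_⟩
  rcases h k hk with h | ⟨hc, hU⟩
  · omega
  · refine (hU e he hke).resolve_right fun heU => ?_
    have : 0 < (U.filter fun x => has k x).card := Finset.card_pos.2 ⟨e, by simp [heU, hke]⟩
    have := Nat.lt_two_pow_self (n := (U.filter fun x => has k x).card)
    rw [hv] at hc
    omega

/-- If the search succeeds, then the player to move wins. -/
theorem forces_of_check {c : ℕ} (U₀ : Finset E) (hinj : Set.InjOn (digitMask has ks) U₀)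
    (hlen : ks.length ≤ 1000) (n : ℕ) : ∀ {U : List E} {M T : Finset E} {w v : K → ℕ},
    (∀ e ∈ U, e ∈ U₀) → U.Nodup → Avoiding has ks U.toFinset M w →
    Building has gs U₀ U.toFinset M v →
    check c (pack gs fun _ => 8) n (U.map (code has ks gs)) (pack ks w) (pack gs v) = true →
    Forces (fun M _ => (∀ k ∈ ks, ∃ e ∈ M, has k e) ∧ ∃ k ∈ gs, ∀ e ∈ U₀, has k e → e ∈ M)
      true U.toFinset M T := by
  induction n with
  | zero => intro U M T w v _ _ _ _ h; simp [check] at h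
  | succ n ih =>
  intro U M T w v hU hn hA hB h
  obtain _ | ⟨x, U⟩ := U
  · simp [check] at h
  rw [List.map_cons, check] at h
  obtain ⟨f', hf', hF⟩ := best_mem c (pack ks w)
    (bif isDone (pack gs fun _ => 8) (pack gs v) then 0 else pack gs v)
    (code has ks gs x :: U.map (code has ks gs)) (code has ks gs x) 0
  rw [hF] at h
  replace hf' : f' ∈ (x :: U).map (code has ks gs) := by simpa using hf'
  obtain ⟨f, hf, rfl⟩ := List.mem_map.1 hf'
  rw [← List.map_cons, without_map hinj hU hn (hU f hf), forced_eq] at h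
  generalize x :: U = U at *
  have hfU : f ∈ U.toFinset := by simpa using hf
  have hA' := hA.claim hfU
  have hB' := hB.claim hfU
  simp only [code, deleted_pack hA.le, doubled_pack (fun k hk => (hB.le k hk).trans (by norm_num)),
    total_pack hlen hA'.le] at h
  rw [← toFinset_erase hn] at hA' hB'
  have hn' : (U.erase f).Nodup := hn.erase f
  have hU' : ∀ e ∈ U.erase f, e ∈ U₀ := fun e he => hU e (List.mem_of_mem_erase he)
  generalize hw' : deleteAt has w f = w' at *
  generalize hv' : doubleAt has v f = v' at *
  -- The default 64 always fails the bound 63, so passing the test certifies that a target set is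
  -- complete.
  have leaf : ∀ {s r : ℕ}, (bif isDone (pack gs fun _ => 8) (pack gs v') then s else 64) + r ≤ 63 →
      s + r ≤ 63 ∧ ∃ k ∈ gs, ∀ e ∈ U₀, has k e → e ∈ insert f M := by
    intro s r hs
    cases hd : isDone (pack gs fun _ => 8) (pack gs v')
    · simp only [hd, cond_false] at hs
      omega
    · simp only [hd, cond_true] at hs
      exact ⟨hs, hB'.of_isDone hd⟩
  -- Once a target set is owned it stays owned, and the Erdős–Selfridge criterion settles the rest.
  have win : ∀ {U M' T : Finset E} {w : K → ℕ}, Avoiding has ks U M' w → (ks.map w).sum < 64 →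
      insert f M ⊆ M' → (∃ k ∈ gs, ∀ e ∈ U₀, has k e → e ∈ insert f M) →
      Forces (fun M _ => (∀ k ∈ ks, ∃ e ∈ M, has k e) ∧ ∃ k ∈ gs, ∀ e ∈ U₀, has k e → e ∈ M)
        true U M' T := by
    rintro U M' T w h1 h2 hM ⟨k, hk, h3⟩
    refine (forces_hit _ rfl h1 h2).with_final.mono fun M'' T'' h => ⟨h.1, k, hk, ?_⟩
    exact fun e he hke => h.2.1 (hM (h3 e he hke))
  rw [Bool.and_eq_true] at h
  refine .move f hfU ?_
  rw [← toFinset_erase hn]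
  refine forces_false_of (fun h0 => ?_) fun e he => ?_
  · have h1 : U.erase f = [] := List.toFinset_eq_empty_iff _ |>.1 h0
    have h2 := h.1
    simp only [h1, List.map_nil, List.isEmpty_nil, Bool.not_true, Bool.false_or] at h2
    obtain ⟨h3, h4⟩ := leaf (r := 0) (Nat.le_of_ble_eq_true h2)
    rw [h0] at hA'
    exact (win (T := T) hA' (by omega) subset_rfl h4).of_empty
  · have he' : e ∈ U.erase f := by simpa using he
    have h2 := List.all_eq_true.1 h.2 _ (List.mem_map_of_mem he')
    have hA'' := hA'.lose he
    have hB'' := hB'.lose he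
    rw [Bool.or_eq_true] at h2
    rcases h2 with h2 | h2
    · rw [code, degree_pack hlen hA'.le] at h2
      obtain ⟨h3, h4⟩ := leaf (Nat.le_of_ble_eq_true h2)
      exact win hA'' (by rw [sum_doubleAt]; omega) subset_rfl h4
    · rw [without_map hinj hU' hn' (hU' e he')] at h2
      simp only [code, doubled_pack hA'.le,
        deleted_pack (fun k hk => (hB'.le k hk).trans (by norm_num : 8 ≤ 64))] at h2
      rw [← toFinset_erase hn'] at hA'' hB'' ⊢
      exact ih (fun x hx => hU' x (List.mem_of_mem_erase hx)) (hn'.erase e) hA'' hB'' h2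

end Soundness

/-! ### Boards with at most eight vertices: reduction to one opening move. -/

section SmallBoards

/-- The edges of the complete graph on `Fin n`, as increasing pairs. -/
def pairs (n : ℕ) : List (Fin n × Fin n) :=
  ((List.finRange n).product (List.finRange n)).filter fun e => e.1 < e.2

/-- The `k`-element subsets of `Fin n`, as increasing lists. -/
def subsets (n k : ℕ) : List (List (Fin n)) :=
  (List.finRange n).sublistsLen k

/-- The edge `e` joins two elements of `k`. -/
def has {n : ℕ} (k : List (Fin n)) (e : Fin n × Fin n) : Bool :=
  k.elem e.1 && k.elem e.2

theorem mem_pairs {n : ℕ} {e : Fin n × Fin n} : e ∈ pairs n ↔ e.1 < e.2 := by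
  obtain ⟨x, y⟩ := e
  simp [pairs, List.pair_mem_product]

theorem nodup_pairs (n : ℕ) : (pairs n).Nodup :=
  ((List.nodup_finRange n).product (List.nodup_finRange n)).filter _

theorem has_iff {n : ℕ} {k : List (Fin n)} {e : Fin n × Fin n} :
    has k e = true ↔ e.1 ∈ k ∧ e.2 ∈ k := by
  simp [has]

/-- Edge-transitivity of the complete graph, used to normalise opening moves. -/
theorem exists_perm {V : Type*} [DecidableEq V] {a b x y : V} (hab : a ≠ b) (hxy : x ≠ y) :
    ∃ σ : Equiv.Perm V, σ a = x ∧ σ b = y := by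
  refine ⟨(Equiv.swap a x).trans (Equiv.swap (Equiv.swap a x b) y), ?_, ?_⟩
  · have : x ≠ Equiv.swap a x b := fun h => hab
      ((Equiv.swap a x).injective ((Equiv.swap_apply_left a x).trans h))
    simp [Equiv.swap_apply_of_ne_of_ne this hxy]
  · simp

theorem mk_eq_mk_of_lt {n : ℕ} {e e' : Fin n × Fin n} (he : e.1 < e.2) (he' : e'.1 < e'.2)
    (σ : Equiv.Perm (Fin n)) (h : s(σ e.1, σ e.2) = s(σ e'.1, σ e'.2)) : e = e' := by
  rcases Sym2.eq_iff.1 h with ⟨h1, h2⟩ | ⟨h1, h2⟩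
  · exact Prod.ext (σ.injective h1) (σ.injective h2)
  · rw [σ.injective h1, σ.injective h2] at he
    exact absurd he he'.not_gt

/-- If every `(r + 1)`-set contains an edge of `M`, then `T` has no clique with more than `r`
vertices. -/
theorem card_le_of_isClq {n r : ℕ} {M T : Finset (Fin n × Fin n)} (hMT : Disjoint M T)
    (hU' : M ∪ T = (pairs n).toFinset) (h1 : ∀ k ∈ subsets n (r + 1), ∃ e ∈ M, has k e)
    (σ : Equiv.Perm (Fin n)) {s : Finset (Fin n)}
    (hs : IsClq (T.image fun e => s(σ e.1, σ e.2)) s) : s.card ≤ r := by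
  by_contra! hlt
  obtain ⟨s', hs's, hs'⟩ := Finset.exists_subset_card_eq (Nat.succ_le_of_lt hlt)
  have hk : (List.finRange n).filter (fun x => σ x ∈ s') ∈ subsets n (r + 1) := by
    refine List.mem_sublistsLen.2 ⟨List.filter_sublist, ?_⟩
    rw [← Nat.succ_eq_add_one, ← hs', ← List.toFinset_card_of_nodup ((List.nodup_finRange n).filter _),
      ← Finset.card_image_of_injective _ σ.injective]
    congr 1
    ext x
    obtain ⟨x, rfl⟩ := σ.surjective x
    simp
  obtain ⟨e, heM, he⟩ := h1 _ hk
  rw [has_iff] at he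
  simp only [List.mem_filter, List.mem_finRange, true_and, decide_eq_true_eq] at he
  have hep : e.1 < e.2 := mem_pairs.1 (List.mem_toFinset.1 (hU' ▸ Finset.mem_union_left _ heM))
  obtain ⟨e', he'T, he'⟩ := Finset.mem_image.1
    (hs _ (hs's he.1) _ (hs's he.2) fun h => hep.ne (σ.injective h))
  have hep' : e'.1 < e'.2 :=
    mem_pairs.1 (List.mem_toFinset.1 (hU' ▸ Finset.mem_union_right _ he'T))
  obtain rfl := mk_eq_mk_of_lt hep' hep σ he'
  exact Finset.disjoint_left.1 hMT heM he'T

/-- By symmetry it suffices to answer one opening move of the first player; the second player wins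
if he owns an edge in each `(r + 1)`-set and all edges in some `r`-set. -/
theorem secondPlayerWins_of_pairs {n r : ℕ} {a b : Fin n} (hab : a < b)
    {Q : Finset (Fin n × Fin n) → Finset (Fin n × Fin n) → Prop}
    (h : Forces Q true ((pairs n).filter (· ≠ (a, b))).toFinset ∅ {(a, b)})
    (hQ : ∀ M T, Q M T → Disjoint M T → M ∪ T = (pairs n).toFinset →
      2 * T.card ≤ (pairs n).length + 2 → (∀ k ∈ subsets n (r + 1), ∃ e ∈ M, has k e) ∧
      ∃ s : Finset (Fin n), s.card = r ∧ ∀ x ∈ s, ∀ y ∈ s, x < y → (x, y) ∈ M) :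
    SecondPlayerWins n := by
  apply secondPlayerWins_of_forces
  refine forces_false_of (fun h0 => ?_) fun e he => ?_
  · have : s(a, b) ∈ allEdges (Fin n) := mem_allEdges.2 hab.ne
    simp [h0] at this
  induction e with
  | _ x y =>
  obtain ⟨σ, rfl, rfl⟩ := exists_perm hab.ne (mem_allEdges.1 he)
  have hmem : (a, b) ∈ pairs n := mem_pairs.2 hab
  have herase : ((pairs n).filter (· ≠ (a, b))).toFinset = (pairs n).toFinset.erase (a, b) :=
    by ext; simp [and_comm]
  have hinj : Set.InjOn (fun e : Fin n × Fin n => s(σ e.1, σ e.2)) (pairs n).toFinset := by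
    intro e he e' he' h
    exact mk_eq_mk_of_lt (mem_pairs.1 (by simpa using he)) (mem_pairs.1 (by simpa using he')) σ h
  have himage : (allEdges (Fin n)).erase s(σ a, σ b) =
      ((pairs n).filter (· ≠ (a, b))).toFinset.image fun e => s(σ e.1, σ e.2) := by
    rw [herase]
    ext e
    induction e with
    | _ x y =>
    obtain ⟨x, rfl⟩ := σ.surjective x
    obtain ⟨y, rfl⟩ := σ.surjective y
    simp only [Finset.mem_erase, mem_allEdges, Finset.mem_image, List.mem_toFinset, mem_pairs]
    constructor
    · rintro ⟨h1, h2⟩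
      rcases lt_or_gt_of_ne (fun h => h2 (congrArg σ h) : x ≠ y) with h | h
      · refine ⟨(x, y), ⟨?_, h⟩, rfl⟩
        rintro ⟨⟩
        exact h1 rfl
      · refine ⟨(y, x), ⟨?_, h⟩, Sym2.eq_swap⟩
        rintro ⟨⟩
        exact h1 Sym2.eq_swap
    · rintro ⟨e, ⟨h1, h2⟩, h3⟩
      rw [← h3]
      refine ⟨fun h => h1 (mk_eq_mk_of_lt h2 hab σ h), fun h => h2.ne ?_⟩
      rcases Sym2.eq_iff.1 h3 with ⟨h4, h5⟩ | ⟨h4, h5⟩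
      · rw [← h4, ← h5] at h; exact σ.injective h
      · rw [← h4, ← h5] at h; exact (σ.injective h).symm
  rw [himage]
  have hd : Disjoint ((pairs n).filter (· ≠ (a, b))).toFinset {(a, b)} := by
    rw [herase]
    simp
  have h' := (h.with_disjoint (by simp) (by simp) hd).with_final
  refine h'.map (fun e => s(σ e.1, σ e.2)) (hinj.mono (by rw [herase]; simp)) ?_
  rintro M T ⟨⟨hQMT, hMT⟩, -, -, hU, hc⟩
  have hU' : M ∪ T = (pairs n).toFinset := by
    rw [hU, herase, Finset.empty_union, ← Finset.insert_eq, Finset.insert_erase (by simpa using hmem)]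
  have hlen := Finset.card_erase_add_one (List.mem_toFinset.2 hmem)
  rw [List.toFinset_card_of_nodup (nodup_pairs n), ← herase] at hlen
  simp only [Finset.card_singleton] at hc
  obtain ⟨h1, t, htr, ht⟩ := hQ M T hQMT hMT hU' (by omega)
  intro s hs
  refine ⟨t.image σ, ?_, ?_⟩
  · intro x hx y hy hxy
    obtain ⟨x, hxt, rfl⟩ := Finset.mem_image.1 hx
    obtain ⟨y, hyt, rfl⟩ := Finset.mem_image.1 hy
    rcases lt_or_gt_of_ne (fun h => hxy (congrArg σ h) : x ≠ y) with h | h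
    · exact Finset.mem_image.2 ⟨(x, y), ht x hxt y hyt h, rfl⟩
    · exact Finset.mem_image.2 ⟨(y, x), ht y hyt x hxt h, Sym2.eq_swap⟩
  · rw [Finset.card_image_of_injective _ σ.injective, htr]
    exact card_le_of_isClq hMT hU' h1 σ hs

end SmallBoards

/-! ### Boards with three to eight vertices, case by case. -/

section SmallBoards

/-- Boards on which the weights `w` let the second player meet every triangle. -/
theorem secondPlayerWins_of_hit {n : ℕ} {a b : Fin n} (hab : a < b) {w : List (Fin n) → ℕ}
    (hw : Avoiding has (subsets n 3) ((pairs n).filter (· ≠ (a, b))).toFinset ∅ w)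
    (hs : ((subsets n 3).map w).sum < 64) (hne : subsets n 3 ≠ []) : SecondPlayerWins n := by
  refine secondPlayerWins_of_pairs (r := 2) hab (forces_hit _ rfl hw hs) ?_
  intro M T h _ hU _
  refine ⟨h, ?_⟩
  obtain ⟨k, hk⟩ := List.exists_mem_of_ne_nil _ hne
  obtain ⟨e, heM, _⟩ := h k hk
  have he : e.1 < e.2 := mem_pairs.1 (List.mem_toFinset.1 (hU ▸ Finset.mem_union_left _ heM))
  refine ⟨{e.1, e.2}, Finset.card_pair he.ne, ?_⟩
  intro x hx y hy hxy
  simp only [Finset.mem_insert, Finset.mem_singleton] at hx hy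
  rcases hx with rfl | rfl <;> rcases hy with rfl | rfl
  · exact absurd hxy (lt_irrefl _)
  · exact heM
  · exact absurd hxy he.not_gt
  · exact absurd hxy (lt_irrefl _)

theorem secondPlayerWins_three : SecondPlayerWins 3 :=
  secondPlayerWins_of_hit (a := 0) (b := 1) (by decide)
    -- A triangle with three free edges weighs `64 / 2 ^ 3`; after the opening, one through `(0, 1)`
    -- has two and weighs 16. The total is 16 here and 48 on four vertices.
    (w := fun k => bif has k (0, 1) then 16 else 8)
    (by unfold Avoiding; decide +kernel) (by decide +kernel) (by decide +kernel)

theorem secondPlayerWins_four : SecondPlayerWins 4 :=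
  secondPlayerWins_of_hit (a := 0) (b := 1) (by decide)
    (w := fun k => bif has k (0, 1) then 16 else 8)
    (by unfold Avoiding; decide +kernel) (by decide +kernel) (by decide +kernel)

/-- The search for the position after the opening move `e₀`. -/
theorem forces_of_check_pairs {n c d : ℕ} (e₀ : Fin n × Fin n) (gs : List (List (Fin n)))
    (v : List (Fin n) → ℕ)
    (hinj : ((pairs n).map (digitMask has (subsets n 4))).Nodup)
    (hlen : (subsets n 4).length ≤ 1000)
    (hA : Avoiding has (subsets n 4) ((pairs n).filter (· ≠ e₀)).toFinset ∅
      fun k => bif has k e₀ then 2 else 1)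
    (hB : Building has gs (pairs n).toFinset ((pairs n).filter (· ≠ e₀)).toFinset ∅ v)
    (h : check c (pack gs fun _ => 8) d
      (((pairs n).filter (· ≠ e₀)).map (code has (subsets n 4) gs))
      (pack (subsets n 4) fun k => bif has k e₀ then 2 else 1) (pack gs v) = true) :
    Forces (fun M _ => (∀ k ∈ subsets n 4, ∃ e ∈ M, has k e) ∧
      ∃ k ∈ gs, ∀ e ∈ (pairs n).toFinset, has k e → e ∈ M)
      true ((pairs n).filter (· ≠ e₀)).toFinset ∅ {e₀} := by
  refine forces_of_check _ ?_ hlen d (fun e he => ?_) ((nodup_pairs n).filter _) hA hB h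
  · intro e he e' he' h
    exact List.inj_on_of_nodup_map hinj (by simpa using he) (by simpa using he') h
  · exact List.mem_toFinset.2 (List.mem_of_mem_filter he)

/-- Boards on which the second player builds a triangle of his own. -/
theorem secondPlayerWins_of_triangle {n : ℕ} {a b : Fin n} (hab : a < b)
    (h : Forces (fun M _ => (∀ k ∈ subsets n 4, ∃ e ∈ M, has k e) ∧
      ∃ k ∈ subsets n 3, ∀ e ∈ (pairs n).toFinset, has k e → e ∈ M)
      true ((pairs n).filter (· ≠ (a, b))).toFinset ∅ {(a, b)}) : SecondPlayerWins n := by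
  refine secondPlayerWins_of_pairs (r := 3) hab h ?_
  rintro M T ⟨h, k, hk, hkM⟩ _ hU _
  obtain ⟨hk1, hk2⟩ := List.mem_sublistsLen.1 hk
  refine ⟨h, k.toFinset, ?_, fun x hx y hy hxy => ?_⟩
  · rw [List.toFinset_card_of_nodup (hk1.nodup (List.nodup_finRange n)), hk2]
  · exact hkM (x, y) (List.mem_toFinset.2 (mem_pairs.2 hxy))
      (has_iff.2 ⟨List.mem_toFinset.1 hx, List.mem_toFinset.1 hy⟩)

/-- Triangles through the opening edge are lost to Bob, hence weight 0; the others start at `8 / 2 ^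
3`. The parameter `c` only steers the choice of moves, and `d` bounds the depth of the search. -/
theorem secondPlayerWins_five : SecondPlayerWins 5 :=
  secondPlayerWins_of_triangle (a := 0) (b := 1) (by decide)
    (forces_of_check_pairs (c := 10) (d := 5) (0, 1) (subsets 5 3)
      (fun k => bif has k (0, 1) then 0 else 1) (by decide +kernel) (by decide +kernel)
      (by unfold Avoiding; decide +kernel) (by unfold Building; decide +kernel) (by decide +kernel))

theorem secondPlayerWins_six : SecondPlayerWins 6 :=
  secondPlayerWins_of_triangle (a := 0) (b := 1) (by decide)
    (forces_of_check_pairs (c := 10) (d := 5) (0, 1) (subsets 6 3)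
      (fun k => bif has k (0, 1) then 0 else 1) (by decide +kernel) (by decide +kernel)
      (by unfold Avoiding; decide +kernel) (by unfold Building; decide +kernel) (by decide +kernel))

set_option maxHeartbeats 0 in
theorem secondPlayerWins_seven : SecondPlayerWins 7 :=
  secondPlayerWins_of_triangle (a := 0) (b := 1) (by decide)
    (forces_of_check_pairs (c := 8) (d := 5) (0, 1) (subsets 7 3)
      (fun k => bif has k (0, 1) then 0 else 1) (by decide +kernel) (by decide +kernel)
      (by unfold Avoiding; decide +kernel) (by unfold Building; decide +kernel) (by decide +kernel))

/-- A blue graph on `8` vertices with more than `12` edges that has no triangle has a vertex with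
four neighbours, which form a red clique. -/
theorem exists_blue_triangle {A B : Finset (Sym2 (Fin 8))} (hAB : allEdges (Fin 8) ⊆ A ∪ B)
    (hB : B ⊆ allEdges (Fin 8)) (hc : 13 ≤ B.card) (hA : ∀ s, IsClq A s → s.card ≤ 3) :
    ∃ s, IsClq B s ∧ s.card = 3 := by
  classical
  by_contra! H
  have hdeg : ∀ v, (SimpleGraph.fromEdgeSet (B : Set (Sym2 (Fin 8)))).degree v ≤ 3 := by
    intro v
    refine hA _ fun x hx y hy hxy => ?_
    rw [SimpleGraph.mem_neighborFinset, SimpleGraph.fromEdgeSet_adj] at hx hy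
    refine (Finset.mem_union.1 (hAB (mem_allEdges.2 hxy))).resolve_right fun hB => ?_
    refine H {v, x, y} ((isClq_iff B _).1 ?_)
      (Finset.card_eq_three.2 ⟨v, x, y, hx.2, hy.2, hxy, rfl⟩)
    have hcl := SimpleGraph.is3Clique_triple_iff
      (G := SimpleGraph.fromEdgeSet (B : Set (Sym2 (Fin 8)))) (a := v) (b := x) (c := y) |>.2
      ⟨by simpa using hx, by simpa using hy, by simpa using ⟨hB, hxy⟩⟩
    exact hcl.isClique
  have hsum := SimpleGraph.sum_degrees_eq_twice_card_edges
    (SimpleGraph.fromEdgeSet (B : Set (Sym2 (Fin 8))))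
  have hE : ∀ i : Fintype (SimpleGraph.fromEdgeSet (B : Set (Sym2 (Fin 8)))).edgeSet,
      @SimpleGraph.edgeFinset _ _ i = B := by
    intro i
    ext e
    simp only [SimpleGraph.mem_edgeFinset, SimpleGraph.edgeSet_fromEdgeSet, Set.mem_sdiff,
      Finset.mem_coe, and_iff_left_iff_imp]
    intro he
    have := hB he
    simpa [allEdges] using this
  rw [hE] at hsum
  have := Finset.sum_le_card_nsmul Finset.univ _ 3 fun v _ => hdeg v
  simp only [Finset.card_univ, Fintype.card_fin, smul_eq_mul] at this
  omega

set_option maxHeartbeats 0 in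
theorem forces_eight : Forces (fun M _ => (∀ k ∈ subsets 8 4, ∃ e ∈ M, has k e) ∧
      ∃ k ∈ [([] : List (Fin 8))], ∀ e ∈ (pairs 8).toFinset, has k e → e ∈ M)
      true ((pairs 8).filter (· ≠ (0, 1))).toFinset ∅ {(0, 1)} :=
  -- The target `[]` contains no edge and has weight 8, so it is complete from the start and only
  -- the 4-sets count. Their total after the opening is 85, too large for the criterion alone; hence
  -- the search.
  forces_of_check_pairs (c := 0) (d := 4) (0, 1) [[]] (fun _ => 8)
    (by decide +kernel) (by decide +kernel)
    (by unfold Avoiding; decide +kernel) (by unfold Building; decide +kernel) (by decide +kernel)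

theorem secondPlayerWins_eight : SecondPlayerWins 8 := by
  refine secondPlayerWins_of_pairs (r := 3) (a := 0) (b := 1) (by decide) forces_eight ?_
  rintro M T ⟨h, -⟩ hMT hU hc
  refine ⟨h, ?_⟩
  have hM : ∀ e ∈ M, e.1 < e.2 := fun e he =>
    mem_pairs.1 (List.mem_toFinset.1 (hU ▸ Finset.mem_union_left _ he))
  have hlen : (pairs 8).length = 28 := by decide +kernel
  have hcard := congrArg Finset.card hU
  rw [Finset.card_union_of_disjoint hMT, List.toFinset_card_of_nodup (nodup_pairs 8), hlen] at hcard
  have htri : ∃ s, IsClq (M.image fun e => s(e.1, e.2)) s ∧ s.card = 3 := by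
    refine exists_blue_triangle (A := T.image fun e => s(e.1, e.2)) ?_ ?_ ?_ fun s hs =>
      card_le_of_isClq hMT hU h (Equiv.refl _) hs
    · intro e
      induction e with
      | _ x y =>
      intro hxy
      rw [← Finset.image_union, Finset.union_comm, hU]
      rcases lt_or_gt_of_ne (mem_allEdges.1 hxy) with h | h
      · exact Finset.mem_image.2 ⟨(x, y), by simpa [mem_pairs] using h, rfl⟩
      · exact Finset.mem_image.2 ⟨(y, x), by simpa [mem_pairs] using h, Sym2.eq_swap⟩
    · intro e he
      obtain ⟨f, hf, rfl⟩ := Finset.mem_image.1 he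
      exact mem_allEdges.2 (hM f hf).ne
    · have hinj : Set.InjOn (fun e : Fin 8 × Fin 8 => s(e.1, e.2)) M := fun e he e' he' h =>
        mk_eq_mk_of_lt (hM e he) (hM e' he') (Equiv.refl _) h
      -- At most 15 of the 28 edges are red, which leaves 13 blue ones.
      rw [Finset.card_image_of_injOn hinj]
      omega
  obtain ⟨s, hs, h3⟩ := htri
  refine ⟨s, h3, fun x hx y hy hxy => ?_⟩
  obtain ⟨e, he, hxe⟩ := Finset.mem_image.1 (hs x hx y hy hxy.ne)
  obtain rfl : e = (x, y) := mk_eq_mk_of_lt (hM e he) hxy (Equiv.refl _) hxe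
  exact he

theorem secondPlayerWins_of_le_eight {n : ℕ} (h3 : 3 ≤ n) (h8 : n ≤ 8) : SecondPlayerWins n := by
  interval_cases n
  · exact secondPlayerWins_three
  · exact secondPlayerWins_four
  · exact secondPlayerWins_five
  · exact secondPlayerWins_six
  · exact secondPlayerWins_seven
  · exact secondPlayerWins_eight

end SmallBoards

/-! ### Ramsey bounds for triangles and 4-cliques. -/

section Ramsey

variable {V : Type*} [DecidableEq V] {M T : Finset (Sym2 V)}

theorem isClq_insert {A : Finset (Sym2 V)} {v : V} {s : Finset V} (hs : IsClq A s)
    (hv : ∀ y ∈ s, s(v, y) ∈ A) : IsClq A (insert v s) := by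
  intro x hx y hy hxy
  rcases Finset.mem_insert.1 hx with rfl | hx' <;> rcases Finset.mem_insert.1 hy with rfl | hy'
  · exact absurd rfl hxy
  · exact hv y hy'
  · exact Sym2.eq_swap ▸ hv x hx'
  · exact hs x hx' y hy' hxy

/-- A red-blue colouring of a set of six vertices has a monochromatic triangle. -/
theorem exists_triangle_of_six {W : Finset V} (hW : 6 ≤ W.card)
    (h : ∀ x ∈ W, ∀ y ∈ W, x ≠ y → s(x, y) ∉ T → s(x, y) ∈ M) :
    (∃ s ⊆ W, IsClq T s ∧ s.card = 3) ∨ ∃ s ⊆ W, IsClq M s ∧ s.card = 3 := by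
  obtain ⟨v, hv⟩ : W.Nonempty := Finset.card_pos.1 (by omega)
  have hcard := Finset.card_filter_add_card_filter_not (s := W.erase v) fun y => s(v, y) ∈ T
  rw [Finset.card_erase_of_mem hv] at hcard
  have main : ∀ A B : Finset (Sym2 V), (∀ x ∈ W, ∀ y ∈ W, x ≠ y → s(x, y) ∉ A → s(x, y) ∈ B) →
      ∀ N ⊆ W.erase v, (∀ y ∈ N, s(v, y) ∈ A) → 3 ≤ N.card →
      (∃ s ⊆ W, IsClq A s ∧ s.card = 3) ∨ ∃ s ⊆ W, IsClq B s ∧ s.card = 3 := by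
    intro A B hAB N hN hvN hc
    by_cases hex : ∃ x ∈ N, ∃ y ∈ N, x ≠ y ∧ s(x, y) ∈ A
    · obtain ⟨x, hx, y, hy, hxy, hA⟩ := hex
      have hx' := Finset.mem_erase.1 (hN hx)
      have hy' := Finset.mem_erase.1 (hN hy)
      refine .inl ⟨{v, x, y}, ?_, isClq_insert (isClq_insert ?_ ?_) ?_,
        Finset.card_eq_three.2 ⟨v, x, y, hx'.1.symm, hy'.1.symm, hxy, rfl⟩⟩
      · intro z hz
        simp only [Finset.mem_insert, Finset.mem_singleton] at hz
        rcases hz with rfl | rfl | rfl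
        exacts [hv, hx'.2, hy'.2]
      · intro z hz w hw hzw
        rw [Finset.mem_singleton] at hz hw
        exact absurd (hz.trans hw.symm) hzw
      · simpa using hA
      · simpa using ⟨hvN x hx, hvN y hy⟩
    · push Not at hex
      obtain ⟨s, hs, hs3⟩ := Finset.exists_subset_card_eq hc
      refine .inr ⟨s, (hs.trans hN).trans (Finset.erase_subset _ _), fun x hx y hy hxy => ?_, hs3⟩
      exact hAB x (Finset.mem_of_mem_erase (hN (hs hx))) y (Finset.mem_of_mem_erase (hN (hs hy)))
        hxy (hex x (hs hx) y (hs hy) hxy)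
  by_cases h3 : 3 ≤ ((W.erase v).filter fun y => s(v, y) ∈ T).card
  · exact main T M h _ (Finset.filter_subset _ _) (fun y hy => (Finset.mem_filter.1 hy).2) h3
  · refine (main M T (fun x hx y hy hxy hM => ?_) _ (Finset.filter_subset _ _) (fun y hy => ?_)
      (by omega : 3 ≤ ((W.erase v).filter fun y => s(v, y) ∉ T).card)).symm
    · by_contra hT
      exact hM (h x hx y hy hxy hT)
    · obtain ⟨h1, h2⟩ := Finset.mem_filter.1 hy
      obtain ⟨h3, h4⟩ := Finset.mem_erase.1 h1
      exact h v hv y h4 h3.symm h2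

/-- `R(3, 4) ≤ 9`. -/
theorem exists_triangle_or_four [Fintype V] {W : Finset V} (hW : W.card = 9)
    (h : ∀ x ∈ W, ∀ y ∈ W, x ≠ y → s(x, y) ∉ T → s(x, y) ∈ M) :
    (∃ s, IsClq T s ∧ s.card = 3) ∨ ∃ s, IsClq M s ∧ s.card = 4 := by
  classical
  by_contra! H
  obtain ⟨HT, HM⟩ := H
  let G : SimpleGraph V :=
    { Adj := fun x y => x ∈ W ∧ y ∈ W ∧ x ≠ y ∧ s(x, y) ∈ T
      symm := ⟨fun x y ⟨h1, h2, h3, h4⟩ => ⟨h2, h1, h3.symm, Sym2.eq_swap ▸ h4⟩⟩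
      loopless := ⟨fun x h => h.2.2.1 rfl⟩ }
  have hdeg : ∀ v, G.degree v = if v ∈ W then 3 else 0 := by
    intro v
    split_ifs with hv
    · have hN : G.neighborFinset v = (W.erase v).filter fun y => s(v, y) ∈ T := by
        ext y
        simp [G, hv, and_assoc, and_left_comm, eq_comm]
      have hcard := Finset.card_filter_add_card_filter_not (s := W.erase v) fun y => s(v, y) ∈ T
      rw [Finset.card_erase_of_mem hv, ← hN, SimpleGraph.card_neighborFinset_eq_degree] at hcard
      -- Four red neighbours would span a blue 4-clique, as there is no red triangle.
      have h1 : G.degree v ≤ 3 := by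
        by_contra! hlt
        rw [← SimpleGraph.card_neighborFinset_eq_degree] at hlt
        obtain ⟨s, hs, hs4⟩ := Finset.exists_subset_card_eq (Nat.succ_le_of_lt hlt)
        refine HM s (fun x hx y hy hxy => ?_) hs4
        have hx' := (G.mem_neighborFinset v x).1 (hs hx)
        have hy' := (G.mem_neighborFinset v y).1 (hs hy)
        refine h x hx'.2.1 y hy'.2.1 hxy fun hT => HT {v, x, y} ?_
          (Finset.card_eq_three.2 ⟨v, x, y, hx'.2.2.1, hy'.2.2.1, hxy, rfl⟩)
        refine isClq_insert (isClq_insert ?_ ?_) ?_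
        · intro z hz w hw hzw
          rw [Finset.mem_singleton] at hz hw
          exact absurd (hz.trans hw.symm) hzw
        · simpa using hT
        · simpa using ⟨hx'.2.2.2, hy'.2.2.2⟩
      -- Six blue neighbours would contain a blue triangle, hence with `v` a blue 4-clique.
      have h2 : ((W.erase v).filter fun y => s(v, y) ∉ T).card ≤ 5 := by
        by_contra! hlt
        have hD : ∀ y ∈ (W.erase v).filter fun y => s(v, y) ∉ T, y ≠ v ∧ y ∈ W ∧ s(v, y) ∉ T := by
          intro y hy
          simpa [and_assoc] using hy
        rcases exists_triangle_of_six (M := M) (T := T) hlt fun x hx y hy =>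
          h x (hD x hx).2.1 y (hD y hy).2.1 with ⟨s, -, hs, hs3⟩ | ⟨s, hsD, hs, hs3⟩
        · exact HT s hs hs3
        · refine HM (insert v s) (isClq_insert hs fun y hy => ?_) ?_
          · obtain ⟨h3, h4, h5⟩ := hD y (hsD hy)
            exact h v hv y h4 h3.symm h5
          · rw [Finset.card_insert_of_notMem fun hvs => (hD v (hsD hvs)).1 rfl, hs3]
      omega
    · rw [← SimpleGraph.card_neighborFinset_eq_degree, Finset.card_eq_zero,
        Finset.eq_empty_iff_forall_notMem]
      intro y hy
      exact hv ((G.mem_neighborFinset v y).1 hy).1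
  -- All nine red degrees equal three, so their sum 27 is odd, against the handshake lemma.
  have hsum := G.sum_degrees_eq_twice_card_edges
  rw [Finset.sum_congr rfl fun v _ => hdeg v, ← Finset.sum_filter, Finset.sum_const,
    Finset.filter_mem_eq_inter, Finset.univ_inter, hW] at hsum
  simp only [smul_eq_mul] at hsum
  omega

end Ramsey

/-! ### Transporting Alice's strategy to the complement of three vertices. -/

section Endgame

/-- `M` has a clique with at least four vertices that is larger than all cliques of `T`. -/
def BigCliqueLT {V : Type*} (M T : Finset (Sym2 V)) : Prop :=
  ∃ s, IsClq M s ∧ 4 ≤ s.card ∧ ∀ s', IsClq T s' → s'.card < s.card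

theorem CliqueLT.bigCliqueLT {V : Type*} [DecidableEq V] [Fintype V] {M T : Finset (Sym2 V)}
    {W : Finset V} (h : CliqueLT M T) (hW : 9 ≤ W.card)
    (hMT : ∀ x ∈ W, ∀ y ∈ W, x ≠ y → s(x, y) ∈ M ∪ T) : BigCliqueLT M T := by
  obtain ⟨W', hW', h9⟩ := Finset.exists_subset_card_eq hW
  have hex := exists_triangle_or_four (M := M) (T := T) h9 fun x hx y hy hxy hT =>
    (Finset.mem_union.1 (hMT x (hW' hx) y (hW' hy) hxy)).resolve_right hT
  by_cases h3 : ∃ s, IsClq T s ∧ s.card = 3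
  · obtain ⟨s, hs, hc⟩ := h3
    obtain ⟨s', hs', hlt⟩ := h
    exact ⟨s', hs', by have := hlt s hs; omega, hlt⟩
  · obtain ⟨s, hs, hc⟩ := hex.resolve_left h3
    refine ⟨s, hs, hc.ge, fun s' hs' => ?_⟩
    by_contra! hlt
    obtain ⟨t, hts, ht⟩ := Finset.exists_subset_card_eq (by omega : 3 ≤ s'.card)
    exact h3 ⟨t, hs'.mono subset_rfl hts, ht⟩

theorem CliqueLT.image {V V' : Type*} [DecidableEq V] [DecidableEq V'] {M T : Finset (Sym2 V)}
    (h : CliqueLT M T) {φ : V → V'} (hφ : Function.Injective φ) :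
    CliqueLT (M.image (Sym2.map φ)) (T.image (Sym2.map φ)) := by
  obtain ⟨s, hs, hlt⟩ := h
  refine ⟨s.image φ, ?_, fun t ht => ?_⟩
  · intro x hx y hy hxy
    obtain ⟨x, hxs, rfl⟩ := Finset.mem_image.1 hx
    obtain ⟨y, hys, rfl⟩ := Finset.mem_image.1 hy
    exact Finset.mem_image.2 ⟨s(x, y), hs x hxs y hys fun h => hxy (h ▸ rfl), rfl⟩
  rw [Finset.card_image_of_injective _ hφ]
  have hmem : ∀ x ∈ t, ∀ y ∈ t, x ≠ y → ∃ x' y', φ x' = x ∧ φ y' = y ∧ s(x', y') ∈ T := by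
    intro x hx y hy hxy
    obtain ⟨e, he, hexy⟩ := Finset.mem_image.1 (ht x hx y hy hxy)
    induction e with
    | _ x' y' =>
    rcases Sym2.eq_iff.1 hexy with ⟨h1, h2⟩ | ⟨h1, h2⟩
    · exact ⟨x', y', h1, h2, he⟩
    · exact ⟨y', x', h2, h1, Sym2.eq_swap ▸ he⟩
  have hT : ∀ t' : Finset V, t'.image φ = t → IsClq T t' := by
    rintro t' rfl x hx y hy hxy
    obtain ⟨x', y', h1, h2, h3⟩ := hmem _ (Finset.mem_image_of_mem φ hx) _
      (Finset.mem_image_of_mem φ hy) (hφ.ne hxy)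
    rwa [hφ h1, hφ h2] at h3
  have hle : ∀ t' : Finset V, t'.image φ = t → t.card < s.card := by
    intro t' ht'
    rw [← ht', Finset.card_image_of_injective _ hφ]
    exact hlt t' (hT t' ht')
  -- A clique with at most one vertex may lie outside the image of `φ`; with two or more, each
  -- vertex is on an edge and so in the image.
  rcases le_or_gt t.card 1 with h1 | h1
  · have h0 : 0 < s.card := by simpa using hlt ∅ (by simp [IsClq])
    obtain ⟨x, hx⟩ := Finset.card_pos.1 h0
    have := hlt {x} fun y hy z hz hyz => by
      rw [Finset.mem_singleton] at hy hz
      exact absurd (hy.trans hz.symm) hyz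
    rw [Finset.card_singleton] at this
    omega
  · have hrange : ∀ x ∈ t, ∃ x', φ x' = x := by
      intro x hx
      obtain ⟨y, hy, hyx⟩ := Finset.exists_mem_ne h1 x
      obtain ⟨x', _, hx', _⟩ := hmem x hx y hy hyx.symm
      exact ⟨x', hx'⟩
    obtain ⟨x₀, hx₀⟩ := Finset.card_pos.1 (zero_lt_one.trans h1)
    have : Nonempty V := ⟨(hrange x₀ hx₀).choose⟩
    choose! ψ hψ using hrange
    refine hle (t.image ψ) ?_
    rw [Finset.image_image]
    ext x
    simp only [Finset.mem_image, Function.comp]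
    constructor
    · rintro ⟨y, hy, rfl⟩
      rwa [hψ y hy]
    · exact fun hx => ⟨x, hx, hψ x hx⟩

/-- The edges of the complete graph that avoid `S`. -/
def edgesOff {V : Type*} [DecidableEq V] [Fintype V] (S : Finset V) : Finset (Sym2 V) :=
  (allEdges V).filter fun e => ∀ x ∈ S, x ∉ e

theorem mem_edgesOff_iff {V : Type*} [DecidableEq V] [Fintype V] {S : Finset V} {e : Sym2 V} :
    e ∈ edgesOff S ↔ e ∈ allEdges V ∧ ∀ x ∈ S, x ∉ e := by
  simp [edgesOff]

/-- The first player's winning strategy on `n` vertices, played by the second player on the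
complement of a set of three vertices with a prescribed opening move. -/
theorem FirstPlayerWins.forces_edgesOff {n : ℕ} (h : FirstPlayerWins n) (hn : 9 ≤ n)
    {S : Finset (Fin (n + 3))} (hS : S.card = 3) {a b : Fin (n + 3)} (hab : a ≠ b) (ha : a ∉ S)
    (hb : b ∉ S) :
    Forces BigCliqueLT false ((edgesOff S).erase s(a, b)) {s(a, b)} ∅ := by
  have h01 : (⟨0, by omega⟩ : Fin n) ≠ ⟨1, by omega⟩ := by simp
  obtain ⟨e, he, hf⟩ := h.forces.exists_move ⟨_, mem_allEdges.2 h01⟩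
  induction e with
  | _ x y =>
  have hxy := mem_allEdges.1 he
  have hcard : Fintype.card (Fin n) = Fintype.card {v // v ∈ Sᶜ} := by
    simp [hS]
  let ι := Fintype.equivOfCardEq hcard
  -- The copy of the board is turned so that the strategy's own first move `xy` lands on `ab`.
  obtain ⟨σ, hσa, hσb⟩ := exists_perm hxy (x := ι.symm ⟨a, by simpa using ha⟩)
    (y := ι.symm ⟨b, by simpa using hb⟩) (by simpa using hab)
  let φ : Fin n → Fin (n + 3) := fun i => (ι (σ i)).1
  have hφ : Function.Injective φ :=
    Subtype.val_injective.comp (ι.injective.comp σ.injective)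
  have hφx : φ x = a := by simp [φ, hσa]
  have hφy : φ y = b := by simp [φ, hσb]
  have hφS : ∀ i, φ i ∉ S := fun i => Finset.mem_compl.1 (ι (σ i)).2
  have hsurj : ∀ v ∉ S, ∃ i, φ i = v := by
    intro v hv
    exact ⟨σ.symm (ι.symm ⟨v, by simpa using hv⟩), by simp [φ]⟩
  have himage : ((allEdges (Fin n)).erase s(x, y)).image (Sym2.map φ) =
      (edgesOff S).erase s(a, b) := by
    rw [← hφx, ← hφy]
    ext e
    induction e with
    | _ v w =>
    simp only [Finset.mem_image, Finset.mem_erase, edgesOff, Finset.mem_filter, mem_allEdges]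
    constructor
    · rintro ⟨e, ⟨h1, h2⟩, h3⟩
      rw [← h3]
      induction e with
      | _ i j =>
      refine ⟨fun h => h1 (Sym2.map.injective hφ h), ?_, ?_⟩
      · rw [← mem_allEdges, ← h3, Sym2.map_mk, mem_allEdges]
        exact hφ.ne (mem_allEdges.1 h2)
      · intro z hz hze
        rcases Sym2.mem_iff.1 hze with rfl | rfl
        · exact hφS _ hz
        · exact hφS _ hz
    · rintro ⟨h1, h2, h3⟩
      obtain ⟨i, rfl⟩ := hsurj v fun hv => h3 v hv (Sym2.mem_mk_left _ _)
      obtain ⟨j, rfl⟩ := hsurj w fun hw => h3 w hw (Sym2.mem_mk_right _ _)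
      refine ⟨s(i, j), ⟨fun h => h1 ?_, mem_allEdges.2 fun h => h2 (h ▸ rfl)⟩, rfl⟩
      exact congrArg (Sym2.map φ) h
  have key := hf.with_final.map (R := BigCliqueLT) (Sym2.map φ)
    (Sym2.map.injective hφ).injOn ?_
  · rw [himage] at key
    simpa [hφx, hφy] using key
  · rintro M T ⟨hMT, -, -, hU, -⟩
    refine (hMT.image hφ).bigCliqueLT (W := Finset.univ.image φ) ?_ ?_
    · rw [Finset.card_image_of_injective _ hφ]
      simpa using hn
    · intro v hv w hw hvw
      obtain ⟨i, -, rfl⟩ := Finset.mem_image.1 hv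
      obtain ⟨j, -, rfl⟩ := Finset.mem_image.1 hw
      rw [← Finset.image_union, hU]
      refine Finset.mem_image.2 ⟨s(i, j), ?_, rfl⟩
      have hij : s(i, j) ∈ allEdges (Fin n) := mem_allEdges.2 fun h => hvw (h ▸ rfl)
      by_cases hxy : s(i, j) = s(x, y)
      · simp [hxy]
      · simp [hxy, hij]

end Endgame

/-! ### The endgame: a large clique off three vertices, and a pairing around them. -/

section Endgame

variable {V : Type*}

theorem BigCliqueLT.monotone : Monotone₂ (BigCliqueLT (V := V)) := by
  rintro M M' T T' hM hT ⟨s, hs, h4, h⟩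
  exact ⟨s, hs.mono hM subset_rfl, h4, fun s' hs' => h s' (hs'.mono hT subset_rfl)⟩

/-- Lets each of two combined games remember its board, so that the opponent's edges can be told
apart afterwards. -/
theorem Monotone₂.and_subset {E : Type*} {Q : Finset E → Finset E → Prop} (hQ : Monotone₂ Q)
    (X : Finset E) : Monotone₂ fun M T => Q M T ∧ T ⊆ X :=
  fun _ _ _ _ hM hT h => ⟨hQ hM hT h.1, hT.trans h.2⟩

variable [DecidableEq V]

theorem mem_edgesOff [Fintype V] {S : Finset V} {x y : V} :
    s(x, y) ∈ edgesOff S ↔ x ≠ y ∧ x ∉ S ∧ y ∉ S := by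
  simp only [mem_edgesOff_iff, mem_allEdges, Sym2.mem_iff]
  constructor
  · rintro ⟨h1, h2⟩
    exact ⟨h1, fun h => h2 _ h (.inl rfl), fun h => h2 _ h (.inr rfl)⟩
  · rintro ⟨h1, h2, h3⟩
    refine ⟨h1, ?_⟩
    rintro z hz (rfl | rfl)
    exacts [h2 hz, h3 hz]

/-- Outside three vertices `r`, `p`, `q` the blue clique is large; `rp` and `rq` are not red and
only the vertices of `X` may be joined to both `p` and `q` by red edges. Then the three vertices
add at most one vertex to a red clique, unless it has at most four vertices. -/
theorem cliqueLE_of_bigCliqueLT {M T₁ T₂ : Finset (Sym2 V)} {r p q : V} {X : Finset V}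
    (hX : X.card ≤ 2) (h : BigCliqueLT M T₁)
    (hT₂ : ∀ x ∉ ({r, p, q} : Finset V), ∀ y ∉ ({r, p, q} : Finset V), s(x, y) ∉ T₂)
    (hrp : s(r, p) ∉ T₁ ∪ T₂) (hrq : s(r, q) ∉ T₁ ∪ T₂) (hr : r ≠ p) (hr' : r ≠ q)
    (hpair : ∀ x ∉ ({r, p, q} : Finset V), x ∉ X → s(x, p) ∈ T₁ ∪ T₂ → s(x, q) ∉ T₁ ∪ T₂) :
    CliqueLE M (T₁ ∪ T₂) := by
  obtain ⟨t, ht, h4, hlt⟩ := h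
  refine fun s hs => ⟨t, ht, ?_⟩
  have hoff : IsClq T₁ (s \ {r, p, q}) := by
    intro x hx y hy hxy
    rw [Finset.mem_sdiff] at hx hy
    exact (Finset.mem_union.1 (hs x hx.1 y hy.1 hxy)).resolve_right (hT₂ x hx.2 y hy.2)
  have hcard := hlt _ hoff
  have hsplit := Finset.card_sdiff_add_card_inter s {r, p, q}
  -- With both `p` and `q`, the clique lies in `X ∪ {p, q}` and has at most four vertices; otherwise
  -- it has at most one vertex in `{r, p, q}`.
  by_cases hpq : p ∈ s ∧ q ∈ s
  · have hrs : r ∉ s := fun hrs => hrp (hs r hrs p hpq.1 hr)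
    have hsub : s ⊆ insert p (insert q X) := by
      intro x hx
      by_contra hxX
      simp only [Finset.mem_insert, not_or] at hxX
      have hxS : x ∉ ({r, p, q} : Finset V) := by
        simp only [Finset.mem_insert, Finset.mem_singleton, not_or]
        exact ⟨fun h => hrs (h ▸ hx), hxX.1, hxX.2.1⟩
      exact hpair x hxS hxX.2.2 (hs x hx p hpq.1 hxX.1) (hs x hx q hpq.2 hxX.2.1)
    have := Finset.card_le_card hsub
    have := Finset.card_insert_le p (insert q X)
    have := Finset.card_insert_le q X
    omega
  · have : (s ∩ {r, p, q}).card ≤ 1 := by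
      rw [Finset.card_le_one]
      intro x hx y hy
      simp only [Finset.mem_inter, Finset.mem_insert, Finset.mem_singleton] at hx hy
      obtain ⟨hx, hx'⟩ := hx
      obtain ⟨hy, hy'⟩ := hy
      by_contra hxy
      have hTxy := hs x hx y hy hxy
      have hTyx := hs y hy x hx (Ne.symm hxy)
      rcases hx' with rfl | rfl | rfl <;> rcases hy' with rfl | rfl | rfl
      exacts [hxy rfl, hrp hTxy, hrq hTxy, hrp hTyx, hxy rfl, hpq ⟨hx, hy⟩, hrq hTyx, hpq ⟨hy, hx⟩,
        hxy rfl]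
    omega

variable [Fintype V]

/-- The second player owns a large clique away from `r`, `p`, `q` by some strategy that begins with
`ab`, he owns `rp` and `rq`, and all edges `T` of the first player meet `{r, p, q}`. -/
theorem forces_endgame {r p q a b : V} {T : Finset (Sym2 V)} {X : Finset V}
    (h : Forces BigCliqueLT false ((edgesOff {r, p, q}).erase s(a, b)) {s(a, b)} ∅)
    (hrp : r ≠ p) (hrq : r ≠ q) (hpq : p ≠ q) (hab : a ≠ b)
    (ha : a ∉ ({r, p, q} : Finset V)) (hb : b ∉ ({r, p, q} : Finset V))
    (hTall : T ⊆ allEdges V) (hTp : s(r, p) ∉ T) (hTq : s(r, q) ∉ T)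
    (hT : ∀ e ∈ T, ∃ x ∈ ({r, p, q} : Finset V), x ∈ e)
    (hX : X.card ≤ 2) (hTX : ∀ x ∉ ({r, p, q} : Finset V), x ∉ X → s(x, p) ∉ T ∧ s(x, q) ∉ T) :
    Forces CliqueLE false (allEdges V \ ({s(r, q), s(r, p), s(a, b)} ∪ T))
      {s(r, q), s(r, p), s(a, b)} T := by
  generalize hS : ({r, p, q} : Finset V) = S at *
  have hmemS : ∀ x, x ∈ S ↔ x = r ∨ x = p ∨ x = q := by
    intro x
    rw [← hS]
    simp
  -- Swapping `p` and `q` pairs `xp` with `xq`. Vertices of `X` are left out because one edge of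
  -- their pair may already be red.
  let σ : Sym2 V → Sym2 V := Sym2.map (Equiv.swap p q)
  have hσ : ∀ e, σ (σ e) = e := by
    intro e
    induction e with
    | _ x y => simp [σ]
  let P : Finset (Sym2 V) :=
    ((Sᶜ \ X).image fun x => s(x, p)) ∪ (Sᶜ \ X).image fun x => s(x, q)
  have hmemP : ∀ e, e ∈ P ↔ ∃ x, x ∉ S ∧ x ∉ X ∧ (e = s(x, p) ∨ e = s(x, q)) := by
    intro e
    simp only [P, Finset.mem_union, Finset.mem_image, Finset.mem_sdiff, Finset.mem_compl]
    constructor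
    · rintro (⟨x, ⟨h1, h2⟩, rfl⟩ | ⟨x, ⟨h1, h2⟩, rfl⟩)
      exacts [⟨x, h1, h2, .inl rfl⟩, ⟨x, h1, h2, .inr rfl⟩]
    · rintro ⟨x, h1, h2, rfl | rfl⟩
      exacts [.inl ⟨x, ⟨h1, h2⟩, rfl⟩, .inr ⟨x, ⟨h1, h2⟩, rfl⟩]
  have hσx : ∀ x ∉ S, σ s(x, p) = s(x, q) ∧ σ s(x, q) = s(x, p) := by
    intro x hx
    rw [hmemS, not_or, not_or] at hx
    simp [σ, Equiv.swap_apply_of_ne_of_ne hx.2.1 hx.2.2]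
  have hP : ∀ e ∈ P, σ e ≠ e ∧ σ e ∈ P := by
    intro e he
    obtain ⟨x, h1, h2, rfl | rfl⟩ := (hmemP e).1 he
    · rw [(hσx x h1).1]
      exact ⟨fun h => hpq (Sym2.congr_right.1 h).symm, (hmemP _).2 ⟨x, h1, h2, .inr rfl⟩⟩
    · rw [(hσx x h1).2]
      exact ⟨fun h => hpq (Sym2.congr_right.1 h), (hmemP _).2 ⟨x, h1, h2, .inl rfl⟩⟩
  have hTP : ∀ e ∈ P, e ∉ T := by
    intro e he
    obtain ⟨x, h1, h2, rfl | rfl⟩ := (hmemP e).1 he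
    exacts [(hTX x h1 h2).1, (hTX x h1 h2).2]
  let O : Finset (Sym2 V) := (allEdges V \ edgesOff S) \ {s(r, q), s(r, p)}
  have hTO : T ⊆ O := by
    intro e he
    simp only [O, Finset.mem_sdiff, Finset.mem_insert, Finset.mem_singleton, not_or]
    refine ⟨⟨hTall he, fun hoff => ?_⟩, fun h => hTq (h ▸ he), fun h => hTp (h ▸ he)⟩
    obtain ⟨x, hx, hxe⟩ := hT e he
    exact (mem_edgesOff_iff.1 hoff).2 x hx hxe
  have f₁ : Forces (fun M T => BigCliqueLT M T ∧ T ⊆ edgesOff S) false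
      ((edgesOff S).erase s(a, b)) {s(a, b)} ∅ := by
    refine h.with_final.mono fun M T h => ⟨h.1, ?_⟩
    rw [Finset.empty_union] at h
    exact h.2.2.1.trans (Finset.erase_subset _ _)
  have f₂ : Forces (fun M T => (∀ e ∈ P, e ∈ T → σ e ∉ T) ∧ T ⊆ O) false
      (O \ T) {s(r, q), s(r, p)} T := by
    refine (forces_pairing σ hσ P hP _ rfl fun e he heT => absurd heT (hTP e he)).with_final.mono
      fun M T' h => ⟨h.1, h.2.2.1.trans ?_⟩
    exact Finset.union_subset hTO Finset.sdiff_subset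
  have hmono : Monotone₂ fun (_ : Finset (Sym2 V)) T => ∀ e ∈ P, e ∈ T → σ e ∉ T :=
    fun M M' T T' _ hT h e he heT heT' => h e he (hT heT) (hT heT')
  have key := Forces.prod (BigCliqueLT.monotone.and_subset _) (hmono.and_subset O) _ rfl ?_ f₁ f₂
  · have hU : (edgesOff S).erase s(a, b) ∪ O \ T =
        allEdges V \ ({s(r, q), s(r, p), s(a, b)} ∪ T) := by
      have hab' : s(a, b) ∈ edgesOff S := mem_edgesOff.2 ⟨hab, ha, hb⟩
      have hrq' : s(r, q) ∉ edgesOff S := fun h => (mem_edgesOff.1 h).2.1 ((hmemS r).2 (.inl rfl))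
      have hrp' : s(r, p) ∉ edgesOff S := fun h => (mem_edgesOff.1 h).2.1 ((hmemS r).2 (.inl rfl))
      have hsub : edgesOff S ⊆ allEdges V := fun e he => (mem_edgesOff_iff.1 he).1
      ext e
      have h1 := @hTO e
      have h2 := @hsub e
      simp only [O, Finset.mem_sdiff, Finset.mem_insert, Finset.mem_singleton, Finset.mem_union,
        Finset.mem_erase, not_or] at h1 ⊢
      by_cases h3 : e = s(a, b)
      · subst h3
        simp [hab']
      by_cases h4 : e = s(r, q)
      · subst h4
        simp [hrq']
      by_cases h5 : e = s(r, p)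
      · subst h5
        simp [hrp']
      tauto
    rw [hU, Finset.empty_union] at key
    have hM : ({s(a, b)} : Finset (Sym2 V)) ∪ {s(r, q), s(r, p)} =
        {s(r, q), s(r, p), s(a, b)} := by
      ext e
      simp only [Finset.mem_union, Finset.mem_insert, Finset.mem_singleton]
      tauto
    rw [hM] at key
    refine key.mono ?_
    rintro M T' ⟨M₁, T₁, M₂, T₂, ⟨hB, hT₁⟩, ⟨hpair, hT₂⟩, rfl, rfl⟩
    have hT₂' : ∀ x y, s(x, y) ∈ T₂ → (x ∈ S ∨ y ∈ S) ∧ s(x, y) ≠ s(r, q) ∧ s(x, y) ≠ s(r, p) := by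
      intro x y hxy
      have := hT₂ hxy
      simp only [O, Finset.mem_sdiff, mem_allEdges, mem_edgesOff, Finset.mem_insert,
        Finset.mem_singleton] at this
      tauto
    have hT₁' : ∀ x y, s(x, y) ∈ T₁ → x ∉ S ∧ y ∉ S := fun x y hxy => (mem_edgesOff.1 (hT₁ hxy)).2
    have hr : r ∈ S := (hmemS r).2 (.inl rfl)
    have hp : p ∈ S := (hmemS p).2 (.inr (.inl rfl))
    have hq : q ∈ S := (hmemS q).2 (.inr (.inr rfl))
    refine cliqueLE_of_bigCliqueLT (r := r) (p := p) (q := q) hX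
      (BigCliqueLT.monotone Finset.subset_union_left subset_rfl hB) ?_ ?_ ?_ hrp hrq ?_
    · rw [hS]
      intro x hx y hy hxy
      exact (hT₂' x y hxy).1.elim hx hy
    · intro h
      rcases Finset.mem_union.1 h with h | h
      · exact (hT₁' _ _ h).1 hr
      · exact (hT₂' _ _ h).2.2 rfl
    · intro h
      rcases Finset.mem_union.1 h with h | h
      · exact (hT₁' _ _ h).1 hr
      · exact (hT₂' _ _ h).2.1 rfl
    · rw [hS]
      intro x hx hxX h1 h2
      replace h1 := (Finset.mem_union.1 h1).resolve_left fun h => (hT₁' _ _ h).2 hp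
      replace h2 := (Finset.mem_union.1 h2).resolve_left fun h => (hT₁' _ _ h).2 hq
      refine hpair _ ((hmemP _).2 ⟨x, hx, hxX, .inl rfl⟩) h1 ?_
      rwa [(hσx x hx).1]
  · rw [Finset.disjoint_left]
    intro e he he'
    simp only [O, Finset.mem_sdiff, Finset.mem_erase] at he he'
    exact he'.1.1.2 he.2

end Endgame

/-! ### Bob's first three moves. -/

section Opening

/-- One round of play; the cardinality bound guarantees that the opponent still has a move. -/
theorem forces_answer {E : Type*} [DecidableEq E] {Q : Finset E → Finset E → Prop}
    {A M T : Finset E} (hc : M.card + T.card < A.card)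
    (h : ∀ e ∈ A, e ∉ M → e ∉ T → ∃ f ∈ A, f ∉ M ∧ f ∉ T ∧ f ≠ e ∧
      Forces Q false (A \ (insert f M ∪ insert e T)) (insert f M) (insert e T)) :
    Forces Q false (A \ (M ∪ T)) M T := by
  refine .reply ?_ fun e he => ?_
  · rw [← Finset.card_pos]
    have := Finset.le_card_sdiff (M ∪ T) A
    have := Finset.card_union_le M T
    omega
  · simp only [Finset.mem_sdiff, Finset.mem_union, not_or] at he
    obtain ⟨f, hf, hfM, hfT, hfe, hF⟩ := h e he.1 he.2.1 he.2.2
    refine .move f (by simp [hf, hfM, hfT, hfe]) ?_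
    convert hF using 1
    ext x
    simp only [Finset.mem_erase, Finset.mem_sdiff, Finset.mem_union, Finset.mem_insert]
    tauto

variable {V : Type*} [DecidableEq V] [Fintype V]

theorem exists_notMem_list (hV : 12 ≤ Fintype.card V) (l : List V) (hl : l.length < 12) :
    ∃ x, x ∉ l := by
  by_contra! h
  have h1 := Finset.card_le_card (fun x _ => List.mem_toFinset.2 (h x) : Finset.univ ⊆ l.toFinset)
  have h2 := l.toFinset_card_le
  rw [Finset.card_univ] at h1
  omega

theorem card_allEdges (hV : 12 ≤ Fintype.card V) : 10 < (allEdges V).card := by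
  have h : (allEdges V).card = (Fintype.card V).choose 2 := by
    rw [← Sym2.card_subtype_not_diag, Fintype.card_subtype]
    rfl
  have h1 : Nat.choose 12 2 ≤ (Fintype.card V).choose 2 := Nat.choose_le_choose 2 hV
  have h2 : Nat.choose 12 2 = 66 := by decide
  omega

/-- The second player has a strategy that gives him, away from any three vertices and after any
opening move there, a large clique. -/
def WinsOff (V : Type*) [DecidableEq V] [Fintype V] : Prop :=
  ∀ S : Finset V, S.card = 3 → ∀ a b, a ≠ b → a ∉ S → b ∉ S →
    Forces BigCliqueLT false ((edgesOff S).erase s(a, b)) {s(a, b)} ∅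

/-- The exceptional set is `{t, d}`: it must contain the outer vertices joined in red to `p` or `q`.
-/
theorem WinsOff.endgame (h : WinsOff V) {r p q a b t d : V} {T : Finset (Sym2 V)}
    (hrp : r ≠ p) (hrq : r ≠ q) (hpq : p ≠ q) (hab : a ≠ b)
    (ha : a ≠ r ∧ a ≠ p ∧ a ≠ q) (hb : b ≠ r ∧ b ≠ p ∧ b ≠ q)
    (hTall : T ⊆ allEdges V) (hTp : s(r, p) ∉ T) (hTq : s(r, q) ∉ T)
    (hT : ∀ e ∈ T, r ∈ e ∨ p ∈ e ∨ q ∈ e)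
    (hTX : ∀ x, x ≠ r → x ≠ p → x ≠ q → x ≠ t → x ≠ d → s(x, p) ∉ T ∧ s(x, q) ∉ T) :
    Forces CliqueLE false (allEdges V \ ({s(r, q), s(r, p), s(a, b)} ∪ T))
      {s(r, q), s(r, p), s(a, b)} T := by
  have ha' : a ∉ ({r, p, q} : Finset V) := by simpa using ha
  have hb' : b ∉ ({r, p, q} : Finset V) := by simpa using hb
  refine forces_endgame (X := {t, d}) (h _ (Finset.card_eq_three.2 ⟨r, p, q, hrp, hrq, hpq, rfl⟩)
    a b hab ha' hb') hrp hrq hpq hab ha' hb' hTall hTp hTq ?_ Finset.card_le_two ?_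
  · simpa using hT
  · intro x hx hxX
    simp only [Finset.mem_insert, Finset.mem_singleton, not_or] at hx hxX
    exact hTX x hx.1 hx.2.1 hx.2.2 hxX.1 hxX.2

/-- The third move of the second player. -/
theorem WinsOff.third (h : WinsOff V) (hV : 12 ≤ Fintype.card V) {u v p t a b : V}
    {e₂ : Sym2 V} (huv : u ≠ v) (hp : p ≠ u ∧ p ≠ v) (ht : t ≠ u ∧ t ≠ v ∧ t ≠ p) (hab : a ≠ b)
    (ha : a ≠ u ∧ a ≠ v ∧ a ≠ p) (hb : b ≠ u ∧ b ≠ v ∧ b ≠ p)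
    (he₂ : e₂ = s(u, t) ∨ e₂ = s(p, t)) :
    Forces CliqueLE false (allEdges V \ ({s(u, p), s(a, b)} ∪ {e₂, s(u, v)}))
      {s(u, p), s(a, b)} {e₂, s(u, v)} := by
  have hall : ∀ {c d : V}, c ≠ d → ({s(c, d), e₂, s(u, v)} : Finset (Sym2 V)) ⊆ allEdges V := by
    intro c d hcd e he
    simp only [Finset.mem_insert, Finset.mem_singleton] at he
    rcases he with rfl | rfl | rfl
    · exact mem_allEdges.2 hcd
    · rcases he₂ with rfl | rfl
      exacts [mem_allEdges.2 ht.1.symm, mem_allEdges.2 ht.2.2.symm]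
    · exact mem_allEdges.2 huv
  refine forces_answer ?_ fun e he heM heT => ?_
  · have := card_allEdges hV
    have := Finset.card_le_two (a := s(u, p)) (b := s(a, b))
    have := Finset.card_le_two (a := e₂) (b := s(u, v))
    omega
  -- Orients the new red edge. If it misses `u`, `v`, `p`, it has an end outside `{a, b}` because
  -- `ab` is taken; that end is `c`.
  suffices H : ∀ c d : V, e = s(c, d) → (c = u ∨ c = p) ∨ (c = v ∧ d ≠ u ∧ d ≠ p) ∨
      (c ≠ u ∧ c ≠ p ∧ c ≠ v ∧ d ≠ u ∧ d ≠ p ∧ d ≠ v ∧ c ≠ a ∧ c ≠ b) →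
      ∃ f ∈ allEdges V, f ∉ ({s(u, p), s(a, b)} : Finset (Sym2 V)) ∧
        f ∉ ({e₂, s(u, v)} : Finset (Sym2 V)) ∧ f ≠ e ∧
        Forces CliqueLE false (allEdges V \ (insert f {s(u, p), s(a, b)} ∪ insert e {e₂, s(u, v)}))
          (insert f {s(u, p), s(a, b)}) (insert e {e₂, s(u, v)}) by
    induction e with
    | _ x y =>
    have h1 := H x y rfl
    have h2 := H y x Sym2.eq_swap
    simp only [Finset.mem_insert, Finset.mem_singleton, Sym2.eq_iff] at heM heT
    have hxy := mem_allEdges.1 he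
    clear H hall
    by_contra hcon
    replace h1 := fun hh => hcon (h1 hh)
    replace h2 := fun hh => hcon (h2 hh)
    clear hcon
    grind
  rintro c d rfl hcd
  have hcd' := mem_allEdges.1 he
  simp only [Finset.mem_insert, Finset.mem_singleton, Sym2.eq_iff] at heM heT
  rcases hcd with hc | ⟨rfl, hd⟩ | hc
  -- The red edge already meets `{u, p}`, so `r = u` and a fresh `q` will do.
  · obtain ⟨q, hq⟩ := exists_notMem_list hV [a, b, u, v, p, t, d] (by simp)
    simp only [List.mem_cons, List.not_mem_nil, or_false, not_or] at hq
    refine ⟨s(u, q), mem_allEdges.2 (by grind), ?_, ?_, ?_,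
      h.endgame (t := t) (d := d) ?_ ?_ ?_ hab ?_ ?_ (hall hcd') ?_ ?_ ?_ ?_⟩ <;>
    simp <;> grind [Sym2.eq_iff]
  -- Here the centre is `p` and the triple is `{p, u, v}`: the red edge `uv` lies inside it.
  · have key := h.endgame (r := p) (p := u) (q := c) (t := t) (d := d) (a := a) (b := b)
      (T := {s(c, d), e₂, s(u, c)}) ?_ ?_ ?_ hab ?_ ?_ (hall hcd') ?_ ?_ ?_ ?_
    · refine ⟨s(p, c), mem_allEdges.2 hp.2, ?_, ?_, ?_, ?_⟩
      · simp; grind [Sym2.eq_iff]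
      · simp; grind [Sym2.eq_iff]
      · simp; grind
      · rwa [Sym2.eq_swap (a := p) (b := u)] at key
    all_goals (simp; grind [Sym2.eq_iff])
  -- The triple is `{u, p, c}`. Its centre is `u` unless `uc` is already red; then it is `p`, and
  -- `v` replaces `t` as exceptional vertex.
  · by_cases hct : e₂ = s(u, c)
    · have key := h.endgame (r := p) (p := u) (q := c) (t := v) (d := d) (a := a) (b := b)
        (T := {s(c, d), e₂, s(u, v)}) ?_ ?_ ?_ hab ?_ ?_ (hall hcd') ?_ ?_ ?_ ?_
      · refine ⟨s(p, c), mem_allEdges.2 hc.2.1.symm, ?_, ?_, ?_, ?_⟩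
        · simp; grind [Sym2.eq_iff]
        · simp; grind [Sym2.eq_iff]
        · simp; grind
        · rwa [Sym2.eq_swap (a := p) (b := u)] at key
      all_goals (simp; grind [Sym2.eq_iff])
    · refine ⟨s(u, c), mem_allEdges.2 hc.1.symm, ?_, ?_, ?_,
        h.endgame (t := t) (d := d) ?_ ?_ ?_ hab ?_ ?_ (hall hcd') ?_ ?_ ?_ ?_⟩ <;>
      simp <;> grind [Sym2.eq_iff]

/-- The second move of the second player. -/
theorem WinsOff.second (h : WinsOff V) (hV : 12 ≤ Fintype.card V) {u v a b : V}
    (huv : u ≠ v) (hab : a ≠ b) (ha : a ≠ u ∧ a ≠ v) (hb : b ≠ u ∧ b ≠ v) :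
    Forces CliqueLE false (allEdges V \ ({s(a, b)} ∪ {s(u, v)})) {s(a, b)} {s(u, v)} := by
  refine forces_answer ?_ fun e he heM heT => ?_
  · have := card_allEdges hV
    simp only [Finset.card_singleton]
    omega
  -- Up to renaming, the second red edge starts at `u` or misses both `u` and `v`; in the latter
  -- case its end `c` is outside `{a, b}`.
  suffices H : ∀ u v c t : V, u ≠ v → (a ≠ u ∧ a ≠ v) → (b ≠ u ∧ b ≠ v) → e = s(c, t) →
      s(c, t) ≠ s(u, v) → c ≠ t → (c = u ∨ (c ≠ u ∧ c ≠ v ∧ t ≠ u ∧ t ≠ v ∧ c ≠ a ∧ c ≠ b)) →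
      ∃ f ∈ allEdges V, f ∉ ({s(a, b)} : Finset (Sym2 V)) ∧ f ∉ ({s(u, v)} : Finset (Sym2 V)) ∧
        f ≠ e ∧ Forces CliqueLE false (allEdges V \ (insert f {s(a, b)} ∪ insert e {s(u, v)}))
          (insert f {s(a, b)}) (insert e {s(u, v)}) by
    induction e with
    | _ x y =>
    have hxy := mem_allEdges.1 he
    rw [Finset.mem_singleton] at heM heT
    have h1 := H u v x y huv ha hb rfl heT hxy
    have h2 := H u v y x huv ha hb Sym2.eq_swap (Sym2.eq_swap ▸ heT) hxy.symm
    have h3 := H v u x y huv.symm ha.symm hb.symm rfl (by rwa [Sym2.eq_swap (a := v)]) hxy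
    have h4 := H v u y x huv.symm ha.symm hb.symm Sym2.eq_swap
      (by rwa [Sym2.eq_swap (a := v), Sym2.eq_swap (a := y)]) hxy.symm
    rw [Sym2.eq_swap (a := v) (b := u)] at h3 h4
    simp only [Sym2.eq_iff] at heM
    clear H
    by_contra hcon
    replace h1 := fun hh => hcon (h1 hh)
    replace h2 := fun hh => hcon (h2 hh)
    replace h3 := fun hh => hcon (h3 hh)
    replace h4 := fun hh => hcon (h4 hh)
    clear hcon
    grind
  rintro u v c t huv ha hb rfl hne hct hc
  have hne' : ¬(c = u ∧ t = v) := fun h => hne (by rw [h.1, h.2])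
  rcases hc with rfl | hc
  · obtain ⟨p, hp⟩ := exists_notMem_list hV [a, b, c, v, t] (by simp)
    simp only [List.mem_cons, List.not_mem_nil, or_false, not_or] at hp
    exact ⟨s(c, p), mem_allEdges.2 (by grind), by simp; grind, by simp; grind, by simp; grind,
      h.third hV huv (by grind) (by grind) hab (by grind) (by grind) (.inl rfl)⟩
  -- Joining the two disjoint red edges makes `c` the vertex `p`, so both of them meet `{u, p}`.
  · exact ⟨s(u, c), mem_allEdges.2 (by grind), by simp; grind, by simp; grind, by simp; grind,
      h.third hV huv (by grind) (by grind) hab (by grind) (by grind) (.inr rfl)⟩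

/-- The second player wins when the first player's strategy works away from three vertices. -/
theorem WinsOff.forces (h : WinsOff V) (hV : 12 ≤ Fintype.card V) :
    Forces CliqueLE false (allEdges V) ∅ ∅ := by
  have key : Forces CliqueLE false (allEdges V \ (∅ ∪ ∅)) ∅ ∅ := by
    refine forces_answer ?_ fun e he _ _ => ?_
    · have := card_allEdges hV
      simp only [Finset.card_empty]
      omega
    induction e with
    | _ u v =>
    have huv := mem_allEdges.1 he
    obtain ⟨a, ha⟩ := exists_notMem_list hV [u, v] (by simp)
    obtain ⟨b, hb⟩ := exists_notMem_list hV [u, v, a] (by simp)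
    simp only [List.mem_cons, List.not_mem_nil, or_false, not_or] at ha hb
    exact ⟨s(a, b), mem_allEdges.2 (Ne.symm hb.2.2), by simp, by simp, by simp; grind,
      h.second hV huv (Ne.symm hb.2.2) ha ⟨hb.1, hb.2.1⟩⟩
  simpa using key

end Opening

theorem FirstPlayerWins.secondPlayerWins_add_three {n : ℕ} (h : FirstPlayerWins n) (hn : 9 ≤ n) :
    SecondPlayerWins (n + 3) :=
  secondPlayerWins_of_forces (WinsOff.forces
    (fun _ hS _ _ hab ha hb => h.forces_edgesOff hn hS hab ha hb) (by simp; omega))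

end CliqueGame

theorem mainTheorem5 :
    (∀ n : ℕ, 8 ≤ n → CliqueGame.FirstPlayerWins n → CliqueGame.SecondPlayerWins (n + 3)) ∧
    (∀ n : ℕ, 3 ≤ n → n ≤ 8 → CliqueGame.SecondPlayerWins n) := by
  refine ⟨fun n hn h => ?_, fun n h3 h8 => CliqueGame.secondPlayerWins_of_le_eight h3 h8⟩
  rcases hn.eq_or_lt with rfl | hn
  -- For eight vertices the hypothesis is false; nine are needed for `R(3, 4) ≤ 9`.
  · exact absurd h CliqueGame.secondPlayerWins_eight.not_gt
  · exact h.secondPlayerWins_add_three hn
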